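/- Let $k\ge 2$ be an integer and let $\Omega\subset\mathbb R^2$ be a strongly convex domain with $C^k$ boundary, i.e. a bounded open convex set whose boundary is a regular simple closed $C^k$ curve with nowhere vanishing curvature. Suppose that $\Omega$ is centrally symmetric about a point $c$, i.e. $\partial\Omega$ is invariant under $x\mapsto 2c-x$. Take $c$ as the origin and let $p(\theta)=\sup_{x\in\Omega}\langle x-c,(\cos\theta,\sin\theta)\rangle$ be the support function of $\Omega$ on $\mathbb S=\mathbb R/2\pi\mathbb Z$. Then $p$ is of class $C^k$, and for every $\varepsilon>0$ there is a strongly convex domain $\Omega_\varepsilon$ with $C^\infty$ boundary, centrally symmetric about $c$, whose support function $p_\varepsilon$ (with respect to $c$) is $C^\infty$ and satisfies $$\|p-p_\varepsilon\|_{k}:=\sum_{j=0}^k\sup_{\theta}\bigl|(p-p_\varepsilon)^{(j)}(\theta)\bigr|<\varepsilon ,$$ and such that the symplectic billiard map of $\Omega_\varepsilon$ has only finitely many $4$-periodic orbits, all of them non-degenerate. Here the symplectic billiard map is defined as follows. Let $\gamma:\mathbb S\to\partial\Omega_\varepsilon$ be a counterclockwise regular parametrization of class $C^2$ with nowhere vanishing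 curvature (the statement holds for each such $\gamma$). For $t\in\mathbb S$ let $t^*\ne t$ be the unique parameter with $\gamma'(t^*)$ parallel to $\gamma'(t)$. The phase space $\hat{\mathcal P}\subset\mathbb S\times\mathbb S$ consists of the pairs $(t_1,t_2)$ such that $t_2$ lies strictly between $t_1$ and $t_1^*$ in the counterclockwise direction. The map is $\hat T:\hat{\mathcal P}\to\hat{\mathcal P}$, $\hat T(t_1,t_2)=(t_2,t_3)$, where $t_3$ is the unique parameter such that $(t_2,t_3)\in\hat{\mathcal P}$ and $\gamma(t_3)-\gamma(t_1)$ is parallel to $\gamma'(t_2)$. A $4$-periodic orbit is the orbit of a point $x\in\hat{\mathcal P}$ with $\hat T^4x=x$; it is non-degenerate if at each of its points the differential $D\hat T^4$ exists and has neither $1$ nor $-1$ as an eigenvalue. -/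

import Mathlib

open scoped ContDiff

noncomputable section

namespace SymplecticBilliard

/-- The Euclidean plane. -/
abbrev Plane : Type := EuclideanSpace ℝ (Fin 2)

/-- `det v w`, the signed area of the parallelogram spanned by `v` and `w`. -/
def det (v w : Plane) : ℝ := v 0 * w 1 - v 1 * w 0

/-- The tangent vector `γ'(t)` of a closed curve `γ : ℝ/2πℤ → ℝ²`. -/
def velocity (γ : Real.Angle → Plane) (t : Real.Angle) : Plane :=
  deriv (fun u : ℝ => γ (t + (u : Real.Angle))) 0

/-- `γ : ℝ/2πℤ → ℝ²` is a counterclockwise regular parametrization of class `C^n` of the boundary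
of `Ω`, and the curvature of this boundary vanishes nowhere. -/
structure IsBoundaryParam (n : WithTop ℕ∞) (γ : Real.Angle → Plane) (Ω : Set Plane) : Prop where
  contDiff : ContDiff ℝ n (fun t : ℝ => γ (t : Real.Angle))
  injective : Function.Injective γ
  range_eq : Set.range γ = frontier Ω
  regular : ∀ t, velocity γ t ≠ 0
  /-- nonzero curvature; the sign expresses the counterclockwise orientation -/
  curvature_pos : ∀ t, 0 < det (velocity γ t) (velocity (velocity γ) t)

/-- `Ω` is a strongly convex planar domain with boundary of class `C^n` (for `2 ≤ n`): a bounded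
open convex set whose boundary is a regular simple closed `C^n` curve with nowhere vanishing
curvature. -/
structure IsStronglyConvexDomain (n : WithTop ℕ∞) (Ω : Set Plane) : Prop where
  isOpen : IsOpen Ω
  isBounded : Bornology.IsBounded Ω
  convex : Convex ℝ Ω
  exists_param : ∃ γ : Real.Angle → Plane, IsBoundaryParam n γ Ω

/-- The boundary of `Ω` is invariant under the point reflection in `c`. -/
def IsCentrallySymmetric (Ω : Set Plane) (c : Plane) : Prop :=
  Equiv.pointReflection c '' frontier Ω = frontier Ω

/-- The support function of `Ω` with respect to the origin `c`; the angle `θ` stands for the outer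
normal `(cos θ, sin θ)`, that is, for the tangent direction `(- sin θ, cos θ)`. -/
def supportFunction (c : Plane) (Ω : Set Plane) (θ : ℝ) : ℝ :=
  sSup ((fun x : Plane => inner ℝ (x - c) !₂[Real.cos θ, Real.sin θ]) '' Ω)

/-- The `C^k` norm of a periodic function of class `C^k`. -/
def ckNorm (k : ℕ) (f : ℝ → ℝ) : ℝ :=
  ∑ j ∈ Finset.range (k + 1), ⨆ θ : ℝ, |iteratedDeriv j f θ|

/-- `(t₁, t₂)` is positive admissible: for a lift `T₁` of `t₁` and the parameter `T₁'` in
`(T₁, T₁ + 2π)` at which the tangent is parallel to the one at `T₁` (it is unique for a strongly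
convex curve), there is a lift `T₂` of `t₂` with `T₁ < T₂ < T₁'`. -/
def PositiveAdmissible (γ : Real.Angle → Plane) (t₁ t₂ : Real.Angle) : Prop :=
  ∃ T₁ T₁' T₂ : ℝ, (T₁ : Real.Angle) = t₁ ∧ (T₂ : Real.Angle) = t₂ ∧
    T₁ < T₁' ∧ T₁' < T₁ + 2 * Real.pi ∧
    det (velocity γ (T₁ : Real.Angle)) (velocity γ (T₁' : Real.Angle)) = 0 ∧
    T₁ < T₂ ∧ T₂ < T₁'

/-- The (open, positive) phase space. -/
def phaseSpace (γ : Real.Angle → Plane) : Set (Real.Angle × Real.Angle) :=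
  {x | PositiveAdmissible γ x.1 x.2}

/-- The parameter `t₃` of the bounce that follows `γ(t₁)`, `γ(t₂)`: the unique one for which
`(t₂, t₃)` is again in the phase space and `γ(t₃) - γ(t₁)` is parallel to `γ'(t₂)`. -/
def nextBounce (γ : Real.Angle → Plane) (t₁ t₂ : Real.Angle) : Real.Angle :=
  Classical.epsilon fun t₃ =>
    (t₂, t₃) ∈ phaseSpace γ ∧ det (velocity γ t₂) (γ t₃ - γ t₁) = 0

/-- The (conservative) symplectic billiard map `(t₁, t₂) ↦ (t₂, t₃)`. Only its values on
`phaseSpace γ`, which it maps to itself, are relevant. -/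
def billiardMap (γ : Real.Angle → Plane) (x : Real.Angle × Real.Angle) :
    Real.Angle × Real.Angle :=
  (x.2, nextBounce γ x.1 x.2)

/-- The 4-periodic points of the symplectic billiard map. -/
def fourPeriodicPoints (γ : Real.Angle → Plane) : Set (Real.Angle × Real.Angle) :=
  {x | x ∈ phaseSpace γ ∧ Function.IsPeriodicPt (billiardMap γ) 4 x}

/-- The 4-periodic orbits of the symplectic billiard map, as subsets of the phase space. -/
def fourPeriodicOrbits (γ : Real.Angle → Plane) : Set (Set (Real.Angle × Real.Angle)) :=
  (fun x => Set.range fun n : ℕ => (billiardMap γ)^[n] x) '' fourPeriodicPoints γ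

/-- The covering map from the plane onto the torus. -/
def torusProj (X : ℝ × ℝ) : Real.Angle × Real.Angle := ((X.1 : Real.Angle), (X.2 : Real.Angle))

/-- `D` is the differential at `x`, in the angular coordinates, of a self-map `f` of the torus:
it is the derivative of a local lift of `f`. -/
def HasTorusDerivAt (f : Real.Angle × Real.Angle → Real.Angle × Real.Angle)
    (D : ℝ × ℝ →L[ℝ] ℝ × ℝ) (x : Real.Angle × Real.Angle) : Prop :=
  ∃ (X : ℝ × ℝ) (F : ℝ × ℝ → ℝ × ℝ), torusProj X = x ∧ HasFDerivAt F D X ∧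
    ∀ᶠ Z in nhds X, torusProj (F Z) = f (torusProj Z)

/-- A 4-periodic point of the symplectic billiard map `T` is non-degenerate if `D(T⁴)` exists there
and has neither `1` nor `-1` as an eigenvalue. -/
def IsNondegenerate (γ : Real.Angle → Plane) (x : Real.Angle × Real.Angle) : Prop :=
  ∃ D : ℝ × ℝ →L[ℝ] ℝ × ℝ, HasTorusDerivAt (billiardMap γ)^[4] D x ∧
    ¬ Module.End.HasEigenvalue (D : ℝ × ℝ →ₗ[ℝ] ℝ × ℝ) 1 ∧
    ¬ Module.End.HasEigenvalue (D : ℝ × ℝ →ₗ[ℝ] ℝ × ℝ) (-1)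

end SymplecticBilliard

end

open SymplecticBilliard

/-! Let `P` be the support function of a centrally symmetric table with respect to its centre; it
is `π`-periodic, and `P > 0`, `P + P'' > 0`. The points of the curve are parametrized by their outer
normals (`envelope`). A `4`-periodic orbit is an inscribed quadrilateral `x₁, x₂, x₃, x₄`
whose diagonal `x₁x₃` is parallel to the tangents at `x₂` and `x₄`, and whose diagonal `x₂x₄` is
parallel to those at `x₁` and `x₃`. Points with parallel tangents are antipodal, so `x₂`
has a tangent parallel to the position vector of `x₁` and vice versa (`fourPeriodic_normals`). In terms of `f = P' / P` the outer
normals `θ₁`, `θ₂` satisfy `f θ₁ = -cot ψ` and `f θ₂ = cot ψ` with `ψ = θ₂ - θ₁`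
(`IsConjugatePair`). Equivalently, `θ₁` is fixed modulo `π` under the square of the conjugation
`θ ↦ θ + π / 2 + arctan (f θ)`. The derivative of this square at `θ₁` is the `multiplier`
`(1 + f' θ₁ sin² ψ) (1 + f' θ₂ sin² ψ)`.

Along such an orbit the differential of the billiard map is, in suitable coordinates, the recursion
`y₃ = -y₁ + a y₂`, `y₄ = -y₂ + b y₃` with coefficients that alternate, where
`a * b = 4 / multiplier` (`differential_antipode`, `multiplier_eq`). The fourth power has the
eigenvalue `1` or `-1` only if `a * b` is `4` or `2` (`eq_zero_of_recursion`). Thus all `4`-periodic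
orbits are non-degenerate as soon as no conjugate pair has multiplier `1` or `2`. The first condition
also makes the zeros of the equation for `θ₁` simple, hence finite in number modulo `2π`.

To achieve both conditions, `log P` is perturbed by a trigonometric polynomial with four
coefficients. The pair `θ₁`, `θ₂`, the derivative at `θ₁` and the multiplier determine the values and
derivatives of the perturbed `f` at both points, hence, by Hermite interpolation
(`interpolate_trigSum`), the four coefficients. So the coefficients for which a given nonzero
multiplier occurs are a `C¹` image of a subset of a three-dimensional space; they have Hausdorff
dimension at most `3`, and their complement is dense (`dense_nonresonant`).

The remaining steps relate support functions to domains. The support function of a strongly convex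
domain with `C^k` boundary is `C^k`, although the inverse Gauss map is only `C^(k-1)`, because `p'` is
the tangential component of the support point (`contDiff_supportFunction`). It is approximated in
`C^k` by smooth periodic functions (`exists_smooth_periodic_approx_of_contDiff`). Conversely, a
smooth positive periodic `P` with `P + P'' > 0` is the support function of the strongly convex domain
`supportDomain c P`, whose boundary is the envelope of the support lines
(`isStronglyConvexDomain_supportDomain`, `supportFunction_supportDomain`). -/

namespace SymplecticBilliard

open Real Filter Topology

/-! ### Normal and tangential components -/

/-- The component of `v` along the outer normal `(cos θ, sin θ)`. -/
noncomputable def normalComp (v : Plane) (θ : ℝ) : ℝ := v 0 * cos θ + v 1 * sin θ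

/-- The component of `v` along the tangent direction `(-sin θ, cos θ)`. -/
noncomputable def tangentComp (v : Plane) (θ : ℝ) : ℝ := v 1 * cos θ - v 0 * sin θ

theorem inner_dir (v : Plane) (θ : ℝ) : inner ℝ v !₂[cos θ, sin θ] = normalComp v θ := by
  simp [normalComp, PiLp.inner_apply, Fin.sum_univ_two, mul_comm]

theorem supportFunction_eq (c : Plane) (Ω : Set Plane) (θ : ℝ) :
    supportFunction c Ω θ = sSup ((fun x : Plane => normalComp (x - c) θ) '' Ω) := by
  simp only [supportFunction, inner_dir]

theorem det_eq_comp (v w : Plane) (θ : ℝ) :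
    det v w = normalComp v θ * tangentComp w θ - tangentComp v θ * normalComp w θ := by
  have := sin_sq_add_cos_sq θ
  simp only [det, normalComp, tangentComp]
  linear_combination (-(v 0 * w 1 - v 1 * w 0)) * this

theorem normalComp_rotate (v : Plane) (θ θ' : ℝ) :
    normalComp v θ' = normalComp v θ * cos (θ' - θ) + tangentComp v θ * sin (θ' - θ) := by
  have := sin_sq_add_cos_sq θ
  simp only [normalComp, tangentComp, cos_sub, sin_sub]
  linear_combination (-(v 0 * cos θ' + v 1 * sin θ')) * this

theorem tangentComp_rotate (v : Plane) (θ θ' : ℝ) :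
    tangentComp v θ' = tangentComp v θ * cos (θ' - θ) - normalComp v θ * sin (θ' - θ) := by
  have := sin_sq_add_cos_sq θ
  simp only [normalComp, tangentComp, cos_sub, sin_sub]
  linear_combination (-(v 1 * cos θ' - v 0 * sin θ')) * this

theorem eq_of_comp_eq {v w : Plane} {θ : ℝ} (h : normalComp v θ = normalComp w θ)
    (h' : tangentComp v θ = tangentComp w θ) : v = w := by
  have := sin_sq_add_cos_sq θ
  simp only [normalComp, tangentComp] at h h'
  ext i
  fin_cases i
  · change v 0 = w 0
    linear_combination cos θ * h - sin θ * h' - (v 0 - w 0) * this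
  · change v 1 = w 1
    linear_combination sin θ * h + cos θ * h' - (v 1 - w 1) * this

theorem normalComp_sub (v w : Plane) (θ : ℝ) :
    normalComp (v - w) θ = normalComp v θ - normalComp w θ := by
  simp [normalComp]; ring

theorem continuous_normalComp : Continuous fun q : Plane × ℝ => normalComp q.1 q.2 := by
  unfold normalComp; fun_prop

theorem hasDerivAt_coord {g : ℝ → Plane} {v : Plane} {T : ℝ} (h : HasDerivAt g v T) (i : Fin 2) :
    HasDerivAt (fun s => g s i) (v i) T :=
  (EuclideanSpace.proj i : Plane →L[ℝ] ℝ).hasFDerivAt.comp_hasDerivAt T h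

theorem hasDerivAt_normalComp_comp {g : ℝ → Plane} {v : Plane} {τ : ℝ → ℝ} {τ' T : ℝ}
    (h : HasDerivAt g v T) (hτ : HasDerivAt τ τ' T) :
    HasDerivAt (fun s => normalComp (g s) (τ s))
      (normalComp v (τ T) + τ' * tangentComp (g T) (τ T)) T := by
  refine (((hasDerivAt_coord h 0).mul hτ.cos).add ((hasDerivAt_coord h 1).mul hτ.sin)).congr_deriv ?_
  simp only [normalComp, tangentComp]; ring

theorem hasDerivAt_tangentComp_comp {g : ℝ → Plane} {v : Plane} {τ : ℝ → ℝ} {τ' T : ℝ}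
    (h : HasDerivAt g v T) (hτ : HasDerivAt τ τ' T) :
    HasDerivAt (fun s => tangentComp (g s) (τ s))
      (tangentComp v (τ T) - τ' * normalComp (g T) (τ T)) T := by
  refine (((hasDerivAt_coord h 1).mul hτ.cos).sub ((hasDerivAt_coord h 0).mul hτ.sin)).congr_deriv ?_
  simp only [normalComp, tangentComp]; ring

theorem contDiffAt_normalComp_comp {n : WithTop ℕ∞} {g : ℝ → Plane} {τ : ℝ → ℝ} {T : ℝ}
    (h : ContDiffAt ℝ n g T) (hτ : ContDiffAt ℝ n τ T) :
    ContDiffAt ℝ n (fun s => normalComp (g s) (τ s)) T := by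
  have h' := contDiffAt_euclidean.1 h
  exact ((h' 0).mul hτ.cos).add ((h' 1).mul hτ.sin)

theorem contDiffAt_tangentComp_comp {n : WithTop ℕ∞} {g : ℝ → Plane} {τ : ℝ → ℝ} {T : ℝ}
    (h : ContDiffAt ℝ n g T) (hτ : ContDiffAt ℝ n τ T) :
    ContDiffAt ℝ n (fun s => tangentComp (g s) (τ s)) T := by
  have h' := contDiffAt_euclidean.1 h
  exact ((h' 1).mul hτ.cos).sub ((h' 0).mul hτ.sin)

theorem det_eq_neg_of_normalComp_eq_zero {v : Plane} {θ : ℝ} (h : normalComp v θ = 0) (w : Plane) :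
    det v w = -(tangentComp v θ * normalComp w θ) := by
  rw [det_eq_comp v w θ, h]; ring

theorem normalComp_add_pi (v : Plane) (θ : ℝ) : normalComp v (θ + π) = -normalComp v θ := by
  simp [normalComp]; ring

theorem tangentComp_add_pi (v : Plane) (θ : ℝ) : tangentComp v (θ + π) = -tangentComp v θ := by
  simp [tangentComp]; ring

theorem normalComp_congr {θ θ' : ℝ} (h : (θ : Real.Angle) = θ') (v : Plane) :
    normalComp v θ = normalComp v θ' := by
  have h1 := congrArg Real.Angle.cos h
  have h2 := congrArg Real.Angle.sin h
  simp only [Real.Angle.cos_coe, Real.Angle.sin_coe] at h1 h2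
  simp only [normalComp, h1, h2]

theorem exists_dir_eq {v : Plane} (hv : v ≠ 0) :
    ∃ θ : ℝ, normalComp v θ = 0 ∧ 0 < tangentComp v θ := by
  -- the polar angle of `v`, turned by a right angle
  set z : ℂ := ⟨v 0, v 1⟩ with hz
  have hz0 : z ≠ 0 := by
    intro h
    apply hv
    have h0 := congrArg Complex.re h
    have h1 := congrArg Complex.im h
    ext i
    fin_cases i
    · simpa using h0
    · simpa using h1
  have hre : v 0 = ‖z‖ * cos (Complex.arg z) := by
    rw [Complex.norm_mul_cos_arg]
  have him : v 1 = ‖z‖ * sin (Complex.arg z) := by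
    rw [Complex.norm_mul_sin_arg]
  have hn : 0 < ‖z‖ := norm_pos_iff.2 hz0
  refine ⟨Complex.arg z - π / 2, ?_, ?_⟩
  · simp only [normalComp, cos_sub_pi_div_two, sin_sub_pi_div_two, hre, him]; ring
  · simp only [tangentComp, cos_sub_pi_div_two, sin_sub_pi_div_two, hre, him]
    have := sin_sq_add_cos_sq (Complex.arg z)
    have h2 : ‖z‖ * sin z.arg * sin z.arg - ‖z‖ * cos z.arg * -cos z.arg = ‖z‖ := by
      linear_combination ‖z‖ * this
    rwa [h2]

/-- A nonzero vector has only one direction. -/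
theorem dir_unique {v : Plane} {θ θ' : ℝ} (h : normalComp v θ = 0) (ht : 0 < tangentComp v θ)
    (h' : normalComp v θ' = 0) (ht' : 0 < tangentComp v θ') : (θ : Real.Angle) = θ' := by
  rw [normalComp_rotate v θ θ', h, zero_mul, zero_add] at h'
  rw [tangentComp_rotate v θ θ', h, zero_mul, sub_zero] at ht'
  have hs : sin (θ' - θ) = 0 := (mul_eq_zero.1 h').resolve_left ht.ne'
  have hc : 0 < cos (θ' - θ) := (pos_iff_pos_of_mul_pos ht').1 ht
  have hc1 : cos (θ' - θ) = 1 := by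
    have := sin_sq_add_cos_sq (θ' - θ)
    nlinarith
  obtain ⟨n, hn⟩ := (Real.cos_eq_one_iff _).1 hc1
  refine (Real.Angle.angle_eq_iff_two_pi_dvd_sub.2 ⟨-n, ?_⟩)
  push_cast
  linarith

/-- A function whose derivative does not vanish at its zeros has finitely many zeros in a
compact set. -/
theorem finite_zeros_of_deriv_ne_zero {f f' : ℝ → ℝ} {K : Set ℝ} (hK : IsCompact K)
    (hf : ∀ x, HasDerivAt f (f' x) x) (hf' : ∀ x, f x = 0 → f' x ≠ 0) :
    {x ∈ K | f x = 0}.Finite := by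
  by_contra hinf
  obtain ⟨x, -, hx⟩ := Set.Infinite.exists_accPt_of_subset_isCompact hinf hK
    (Set.sep_subset _ _)
  have hcont : Continuous f := continuous_iff_continuousAt.2 fun x => (hf x).continuousAt
  have hfr : ∃ᶠ y in 𝓝[≠] x, f y = 0 :=
    (accPt_iff_frequently_nhdsNE.1 hx).mono fun y hy => hy.2
  have hfx : f x = 0 := by
    have hcl : IsClosed {y | f y = 0} := isClosed_eq hcont continuous_const
    exact hcl.mem_of_frequently_of_tendsto hfr
      (tendsto_id.mono_left nhdsWithin_le_nhds)
  have := (hf x).eventually_ne (c := 0) (hf' x hfx)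
  exact hfr this

/-! ### The lift of a closed curve -/

theorem deriv_translate_angle {E : Type*} [NormedAddCommGroup E] [NormedSpace ℝ E]
    (γ : Real.Angle → E) (T : ℝ) :
    deriv (fun u : ℝ => γ ((T : Real.Angle) + (u : Real.Angle))) 0
      = deriv (fun s : ℝ => γ (s : Real.Angle)) T := by
  have := deriv_comp_const_add (fun s : ℝ => γ (s : Real.Angle)) T 0
  simpa using this

theorem velocity_coe (γ : Real.Angle → Plane) (T : ℝ) :
    velocity γ (T : Real.Angle) = deriv (fun s : ℝ => γ (s : Real.Angle)) T :=
  deriv_translate_angle γ T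

section Param

variable {n : WithTop ℕ∞} {γ : Real.Angle → Plane} {Ω : Set Plane}

theorem IsBoundaryParam.hasDerivAt (h : IsBoundaryParam n γ Ω) (hn : 2 ≤ n) (T : ℝ) :
    HasDerivAt (fun s : ℝ => γ (s : Real.Angle)) (velocity γ (T : Real.Angle)) T := by
  rw [velocity_coe]
  exact ((h.contDiff.differentiable (by rintro rfl; simp at hn)) T).hasDerivAt

theorem IsBoundaryParam.contDiff_velocity (h : IsBoundaryParam n γ Ω) {m : WithTop ℕ∞}
    (hm : m + 1 ≤ n) : ContDiff ℝ m (fun s : ℝ => velocity γ (s : Real.Angle)) := by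
  have h1 : (fun s : ℝ => velocity γ (s : Real.Angle)) = deriv (fun s : ℝ => γ (s : Real.Angle)) :=
    funext fun T => velocity_coe γ T
  rw [h1]
  exact (contDiff_succ_iff_deriv.1 (h.contDiff.of_le hm)).2.2

theorem IsBoundaryParam.hasDerivAt_velocity (h : IsBoundaryParam n γ Ω) (hn : 2 ≤ n) (T : ℝ) :
    HasDerivAt (fun s : ℝ => velocity γ (s : Real.Angle))
      (velocity (velocity γ) (T : Real.Angle)) T := by
  rw [velocity_coe (velocity γ)]
  have h1 : ContDiff ℝ 1 (fun s : ℝ => velocity γ (s : Real.Angle)) :=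
    h.contDiff_velocity (by rw [one_add_one_eq_two]; exact hn)
  exact ((h1.differentiable (by simp)) T).hasDerivAt

end Param

/-! ### The support function of a strongly convex curve -/

/-- The point `γ(T)` maximizes the height in the direction of the outer normal `(cos θ, sin θ)`. -/
def SupportsAt (γ : Real.Angle → Plane) (T θ : ℝ) : Prop :=
  ∀ t : Real.Angle, normalComp (γ t) θ ≤ normalComp (γ (T : Real.Angle)) θ

theorem SupportsAt.congr {γ : Real.Angle → Plane} {T θ θ' : ℝ} (h : SupportsAt γ T θ)
    (hθ : (θ : Real.Angle) = θ') : SupportsAt γ T θ' := by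
  intro t
  rw [← normalComp_congr hθ, ← normalComp_congr hθ]
  exact h t

theorem SupportsAt.congr_left {γ : Real.Angle → Plane} {T T' θ : ℝ} (h : SupportsAt γ T θ)
    (hT : (T : Real.Angle) = T') : SupportsAt γ T' θ := by
  intro t
  rw [← hT]
  exact h t

section Support

variable {n : WithTop ℕ∞} {γ : Real.Angle → Plane} {Ω : Set Plane}

theorem IsBoundaryParam.exists_supportsAt (h : IsBoundaryParam n γ Ω) (θ : ℝ) :
    ∃ T : ℝ, SupportsAt γ T θ := by
  have hc : Continuous fun s : ℝ => normalComp (γ (s : Real.Angle)) θ :=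
    continuous_normalComp.comp (h.contDiff.continuous.prodMk continuous_const)
  obtain ⟨T, -, hT⟩ := (isCompact_Icc (a := -π) (b := π)).exists_isMaxOn
    ⟨0, by constructor <;> linarith [pi_pos]⟩ hc.continuousOn
  refine ⟨T, fun t => ?_⟩
  have := hT (a := t.toReal) ⟨(Real.Angle.neg_pi_lt_toReal t).le, Real.Angle.toReal_le_pi t⟩
  simpa using this

theorem exists_lt_normalComp (hΩ : IsOpen Ω) {x : Plane} (hx : x ∈ Ω) (θ : ℝ) :
    ∃ y ∈ Ω, normalComp x θ < normalComp y θ := by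
  have hcont : ContinuousAt (fun s : ℝ => x + s • !₂[cos θ, sin θ]) 0 := by fun_prop
  have hev : ∀ᶠ s : ℝ in 𝓝 0, x + s • !₂[cos θ, sin θ] ∈ Ω :=
    hcont.eventually_mem (hΩ.mem_nhds (by simpa using hx))
  obtain ⟨s, hs, hs0⟩ := ((hev.filter_mono nhdsWithin_le_nhds).and
    (self_mem_nhdsWithin (s := Set.Ioi (0 : ℝ)))).exists
  refine ⟨_, hs, ?_⟩
  have h1 : normalComp (x + s • !₂[cos θ, sin θ]) θ = normalComp x θ + s := by
    have := sin_sq_add_cos_sq θ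
    simp [normalComp]
    linear_combination s * this
  rw [h1]
  linarith [show (0 : ℝ) < s from hs0]

theorem IsBoundaryParam.le_of_mem_closure (h : IsBoundaryParam n γ Ω) (ho : IsOpen Ω)
    (hb : Bornology.IsBounded Ω) {T θ : ℝ} (hT : SupportsAt γ T θ) {x : Plane}
    (hx : x ∈ closure Ω) : normalComp x θ ≤ normalComp (γ (T : Real.Angle)) θ := by
  have hcomp : IsCompact (closure Ω) := hb.isCompact_closure
  have hc : Continuous fun v : Plane => normalComp v θ :=
    continuous_normalComp.comp (continuous_id.prodMk continuous_const)
  obtain ⟨y, hy, hmax⟩ := hcomp.exists_isMaxOn ⟨x, hx⟩ hc.continuousOn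
  refine (hmax hx).trans ?_
  have hyΩ : y ∉ Ω := by
    intro hyΩ
    obtain ⟨z, hz, hlt⟩ := exists_lt_normalComp ho hyΩ θ
    exact absurd (hmax (subset_closure hz)) (not_le.2 hlt)
  have hfr : y ∈ frontier Ω := by
    rw [ho.frontier_eq]; exact ⟨hy, hyΩ⟩
  rw [← h.range_eq] at hfr
  obtain ⟨t, rfl⟩ := hfr
  exact hT t

theorem IsBoundaryParam.mem_closure (h : IsBoundaryParam n γ Ω) (t : Real.Angle) :
    γ t ∈ closure Ω :=
  frontier_subset_closure (h.range_eq ▸ Set.mem_range_self t)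

theorem IsBoundaryParam.supportFunction_eq (h : IsBoundaryParam n γ Ω) (ho : IsOpen Ω)
    (hb : Bornology.IsBounded Ω) (c : Plane) {T θ : ℝ} (hT : SupportsAt γ T θ) :
    supportFunction c Ω θ = normalComp (γ (T : Real.Angle) - c) θ := by
  have hne : Ω.Nonempty := closure_nonempty_iff.1 ⟨_, h.mem_closure 0⟩
  rw [SymplecticBilliard.supportFunction_eq]
  refine IsLUB.csSup_eq ⟨?_, ?_⟩ (hne.image _)
  · rintro _ ⟨x, hx, rfl⟩
    simp only [normalComp_sub]
    linarith [h.le_of_mem_closure ho hb hT (subset_closure hx)]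
  · intro b hub
    have hc : Continuous fun v : Plane => normalComp (v - c) θ :=
      continuous_normalComp.comp ((continuous_id.sub continuous_const).prodMk continuous_const)
    have hcl : closure Ω ⊆ {v | normalComp (v - c) θ ≤ b} :=
      closure_minimal (fun x hx => hub ⟨x, hx, rfl⟩) (isClosed_le hc continuous_const)
    exact hcl (h.mem_closure _)

theorem IsBoundaryParam.normalComp_velocity_eq_zero (h : IsBoundaryParam n γ Ω) (hn : 2 ≤ n)
    {T θ : ℝ} (hT : SupportsAt γ T θ) : normalComp (velocity γ (T : Real.Angle)) θ = 0 := by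
  have hd := hasDerivAt_normalComp_comp (h.hasDerivAt hn T) (hasDerivAt_const T θ)
  have hmax : IsLocalMax (fun s : ℝ => normalComp (γ (s : Real.Angle)) θ) T :=
    Eventually.of_forall fun s => hT s
  simpa using hmax.hasDerivAt_eq_zero hd

/-- The second derivative test, combined with the orientation of the curve: at the point with outer
normal `(cos θ, sin θ)`, the velocity is a positive multiple of `(-sin θ, cos θ)`. -/
theorem IsBoundaryParam.comp_velocity (h : IsBoundaryParam n γ Ω) (hn : 2 ≤ n)
    {T θ : ℝ} (hT : SupportsAt γ T θ) : 0 < tangentComp (velocity γ (T : Real.Angle)) θ ∧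
      normalComp (velocity (velocity γ) (T : Real.Angle)) θ < 0 := by
  have h0 := h.normalComp_velocity_eq_zero hn hT
  have hcurv := h.curvature_pos T
  rw [det_eq_neg_of_normalComp_eq_zero h0] at hcurv
  suffices hneg : normalComp (velocity (velocity γ) (T : Real.Angle)) θ ≤ 0 by
    have hlt := hneg.lt_of_ne (by intro h1; rw [h1] at hcurv; simp at hcurv)
    exact ⟨by nlinarith, hlt⟩
  by_contra! hpos
  have hd : ∀ S : ℝ, HasDerivAt (fun s : ℝ => normalComp (γ (s : Real.Angle)) θ)
      (normalComp (velocity γ (S : Real.Angle)) θ) S := fun S => by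
    simpa using hasDerivAt_normalComp_comp (h.hasDerivAt hn S) (hasDerivAt_const S θ)
  have hd2 : HasDerivAt (fun s : ℝ => normalComp (velocity γ (s : Real.Angle)) θ)
      (normalComp (velocity (velocity γ) (T : Real.Angle)) θ) T := by
    simpa using hasDerivAt_normalComp_comp (h.hasDerivAt_velocity hn T) (hasDerivAt_const T θ)
  have hderiv : deriv (fun s : ℝ => normalComp (γ (s : Real.Angle)) θ)
      = fun s : ℝ => normalComp (velocity γ (s : Real.Angle)) θ := funext fun S => (hd S).deriv
  have hmin : IsLocalMin (fun s : ℝ => normalComp (γ (s : Real.Angle)) θ) T :=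
    isLocalMin_of_deriv_deriv_pos (by rw [hderiv, hd2.deriv]; exact hpos)
      (by rw [hderiv]; exact h0) (hd T).continuousAt
  -- a point that is both a minimum and a maximum: the height is locally constant
  have hconst : (fun s : ℝ => normalComp (γ (s : Real.Angle)) θ)
      =ᶠ[𝓝 T] fun _ => normalComp (γ (T : Real.Angle)) θ :=
    hmin.mono fun s hs => le_antisymm (hT s) hs
  have h2 := hconst.deriv.deriv_eq
  rw [hderiv, hd2.deriv] at h2
  simp at h2
  linarith

/-- Every boundary point has a supporting line (Hahn-Banach). -/
theorem IsBoundaryParam.exists_normal (h : IsBoundaryParam n γ Ω) (ho : IsOpen Ω)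
    (hconv : Convex ℝ Ω) (T : ℝ) : ∃ θ : ℝ, SupportsAt γ T θ := by
  have hT : γ (T : Real.Angle) ∉ Ω := by
    have : γ (T : Real.Angle) ∈ frontier Ω := h.range_eq ▸ Set.mem_range_self _
    rw [ho.frontier_eq] at this
    exact this.2
  obtain ⟨f, hf⟩ := geometric_hahn_banach_open_point hconv ho hT
  set w : Plane := (InnerProductSpace.toDual ℝ Plane).symm f with hw
  have hfw : ∀ x, f x = inner ℝ w x := fun x => by simp [hw]
  have hne : Ω.Nonempty := closure_nonempty_iff.1 ⟨_, h.mem_closure 0⟩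
  have hw0 : w ≠ 0 := by
    obtain ⟨x, hx⟩ := hne
    intro h0
    have := hf x hx
    rw [hfw, hfw, h0] at this
    simp at this
  obtain ⟨θ, h1, h2⟩ := exists_dir_eq hw0
  -- `w` is a positive multiple of the normal at angle `θ + π / 2`
  have hexp : ∀ x, f x = tangentComp w θ * normalComp x (θ + π / 2) := by
    intro x
    have hs := sin_sq_add_cos_sq θ
    rw [hfw]
    simp only [PiLp.inner_apply, Fin.sum_univ_two, normalComp, tangentComp, cos_add_pi_div_two,
      sin_add_pi_div_two] at h1 ⊢
    simp only [RCLike.inner_apply, conj_trivial]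
    linear_combination (cos θ * x 0 + sin θ * x 1) * h1 - (w 0 * x 0 + w 1 * x 1) * hs
  refine ⟨θ + π / 2, fun t => ?_⟩
  have hcont : Continuous f := f.continuous
  have hcl : closure Ω ⊆ {v | f v ≤ f (γ (T : Real.Angle))} :=
    closure_minimal (fun x hx => (hf x hx).le) (isClosed_le hcont continuous_const)
  have := hcl (h.mem_closure t)
  simp only [Set.mem_ofPred_eq, hexp] at this
  exact le_of_mul_le_mul_left this h2

theorem IsBoundaryParam.normal_unique (h : IsBoundaryParam n γ Ω) (hn : 2 ≤ n) {T θ θ' : ℝ}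
    (hT : SupportsAt γ T θ) (hT' : SupportsAt γ T θ') : (θ : Real.Angle) = θ' :=
  dir_unique (h.normalComp_velocity_eq_zero hn hT) (h.comp_velocity hn hT).1
    (h.normalComp_velocity_eq_zero hn hT') (h.comp_velocity hn hT').1

/-- Strict convexity. If a supporting line touched the curve in two points, then it would contain a
segment of the curve, and the zeros of the normal velocity would not be isolated. -/
theorem IsBoundaryParam.param_unique (h : IsBoundaryParam n γ Ω) (hn : 2 ≤ n) (ho : IsOpen Ω)
    (hb : Bornology.IsBounded Ω) (hconv : Convex ℝ Ω) {T T' θ : ℝ}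
    (hT : SupportsAt γ T θ) (hT' : SupportsAt γ T' θ) : (T : Real.Angle) = T' := by
  by_contra hne
  have hγ : γ (T : Real.Angle) ≠ γ (T' : Real.Angle) := fun h' => hne (h.injective h')
  have hval : normalComp (γ (T : Real.Angle)) θ = normalComp (γ (T' : Real.Angle)) θ :=
    le_antisymm (hT' _) (hT _)
  set q : ℝ → Plane := fun s =>
    γ (T : Real.Angle) + s • (γ (T' : Real.Angle) - γ (T : Real.Angle)) with hq
  have hqn : ∀ s, normalComp (q s) θ = normalComp (γ (T : Real.Angle)) θ := by
    intro s
    simp only [normalComp] at hval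
    simp [hq, normalComp]
    linear_combination (-s) * hval
  have hqfr : ∀ s ∈ Set.Icc (0 : ℝ) 1, q s ∈ Set.range γ := by
    intro s hs
    rw [h.range_eq, ho.frontier_eq]
    refine ⟨?_, fun hmem => ?_⟩
    · exact hconv.closure.add_smul_sub_mem (h.mem_closure _) (h.mem_closure _) hs
    · obtain ⟨y, hy, hlt⟩ := exists_lt_normalComp ho hmem θ
      rw [hqn] at hlt
      exact absurd (h.le_of_mem_closure ho hb hT (subset_closure hy)) (not_le.2 hlt)
  choose! τ hτ using hqfr
  have hinj : Set.InjOn (fun s => (τ s).toReal) (Set.Icc (0 : ℝ) 1) := by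
    intro s hs s' hs' heq
    have h1 : q s = q s' := by
      rw [← hτ s hs, ← hτ s' hs', Real.Angle.toReal_injective heq]
    have h2 : (s - s') • (γ (T' : Real.Angle) - γ (T : Real.Angle)) = 0 := by
      simp only [hq] at h1
      rw [sub_smul, sub_eq_zero]
      exact add_left_cancel h1
    rcases smul_eq_zero.1 h2 with h3 | h3
    · linarith
    · exact absurd (sub_eq_zero.1 h3).symm hγ
  have hinf : ((fun s => (τ s).toReal) '' Set.Icc (0 : ℝ) 1).Infinite :=
    (Set.Icc_infinite zero_lt_one).image hinj
  have hfin := finite_zeros_of_deriv_ne_zero (K := Set.Icc (-π) π) isCompact_Icc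
    (f := fun s : ℝ => normalComp (velocity γ (s : Real.Angle)) θ)
    (f' := fun s : ℝ => normalComp (velocity (velocity γ) (s : Real.Angle)) θ)
    (fun S => by
      simpa using hasDerivAt_normalComp_comp (h.hasDerivAt_velocity hn S) (hasDerivAt_const S θ))
    (fun S hS h0 => by
      have := h.curvature_pos S
      rw [det_eq_neg_of_normalComp_eq_zero hS, h0] at this
      simp at this)
  refine hinf (hfin.subset ?_)
  rintro _ ⟨s, hs, rfl⟩
  refine ⟨⟨(Real.Angle.neg_pi_lt_toReal _).le, Real.Angle.toReal_le_pi _⟩, ?_⟩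
  refine h.normalComp_velocity_eq_zero hn fun t => ?_
  rw [Real.Angle.coe_toReal, hτ s hs, hqn]
  exact hT t

/-- Near a boundary point, the outer normal determines the point, with one degree of smoothness
less than the curve has. -/
theorem IsBoundaryParam.exists_local_inverse (h : IsBoundaryParam n γ Ω) (hn : 2 ≤ n)
    (ho : IsOpen Ω) (hconv : Convex ℝ Ω) {m : WithTop ℕ∞} (hm : m + 1 ≤ n) (hm1 : 1 ≤ m)
    {T θ : ℝ} (hT : SupportsAt γ T θ) :
    ∃ Ψ : ℝ → ℝ, Ψ θ = T ∧ ContDiffAt ℝ m Ψ θ ∧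
      HasDerivAt Ψ (-(tangentComp (velocity γ (T : Real.Angle)) θ) /
        normalComp (velocity (velocity γ) (T : Real.Angle)) θ) θ ∧
      ∀ᶠ θ' in 𝓝 θ, SupportsAt γ (Ψ θ') θ' := by
  obtain ⟨hμ, hν⟩ := h.comp_velocity hn hT
  have h0 := h.normalComp_velocity_eq_zero hn hT
  set N : ℝ → ℝ := fun s => normalComp (velocity γ (s : Real.Angle)) θ with hN
  set M : ℝ → ℝ := fun s => tangentComp (velocity γ (s : Real.Angle)) θ with hM
  set Φ : ℝ → ℝ := fun s => θ + arctan (-N s / M s) with hΦ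
  have hMT : M T ≠ 0 := hμ.ne'
  have hvel := (h.contDiff_velocity hm).contDiffAt (x := T)
  have hNc : ContDiffAt ℝ m N T := contDiffAt_normalComp_comp hvel contDiffAt_const
  have hMc : ContDiffAt ℝ m M T := contDiffAt_tangentComp_comp hvel contDiffAt_const
  have hΦc : ContDiffAt ℝ m Φ T := contDiffAt_const.add (contDiff_arctan.contDiffAt.comp T (hNc.neg.div hMc hMT))
  have hNd : HasDerivAt N (normalComp (velocity (velocity γ) (T : Real.Angle)) θ) T := by
    simpa using hasDerivAt_normalComp_comp (h.hasDerivAt_velocity hn T) (hasDerivAt_const T θ)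
  have hMd : HasDerivAt M _ T := hasDerivAt_tangentComp_comp (h.hasDerivAt_velocity hn T) (hasDerivAt_const T θ)
  have hΦd : HasDerivAt Φ (-normalComp (velocity (velocity γ) (T : Real.Angle)) θ / M T) T := by
    refine (((hNd.neg.div hMd hMT).arctan).const_add θ).congr_deriv ?_
    have : N T = 0 := h0
    simp only [zero_mul, sub_zero, Pi.neg_apply, Pi.div_apply, this, neg_zero, zero_div]
    field_simp
    simp
  have hΦT : Φ T = θ := by
    have : N T = 0 := h0
    simp [hΦ, this]
  have hd0 : -normalComp (velocity (velocity γ) (T : Real.Angle)) θ / M T ≠ 0 :=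
    div_ne_zero (by linarith) hMT
  have hm0 : m ≠ 0 := by rintro rfl; simp at hm1
  have hΦf := hΦd.hasFDerivAt_equiv hd0
  have hval : hΦc.localInverse hΦf hm0 θ = T := by
    have := hΦc.localInverse_apply_image hΦf hm0
    rwa [hΦT] at this
  refine ⟨hΦc.localInverse hΦf hm0, hval, ?_, ?_, ?_⟩
  · have := hΦc.to_localInverse hΦf hm0
    rwa [hΦT] at this
  · have h1 := (hΦc.hasStrictFDerivAt' hΦf hm0).to_localInverse
    rw [hΦT] at h1
    have h2 := h1.hasFDerivAt.hasDerivAt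
    refine h2.congr_deriv ?_
    simp [ContinuousLinearEquiv.unitsEquivAut, hM]
    field_simp
  · have hr := (hΦc.hasStrictFDerivAt' hΦf hm0).eventually_right_inverse
    have hcont : ContinuousAt (hΦc.localInverse hΦf hm0) θ := by
      have := (hΦc.to_localInverse hΦf hm0).continuousAt
      rwa [hΦT] at this
    have hMpos : ∀ᶠ s in 𝓝 T, 0 < M s :=
      hMc.continuousAt.eventually (lt_mem_nhds hμ)
    have hsup : ∀ᶠ s in 𝓝 T, SupportsAt γ s (Φ s) := by
      filter_upwards [hMpos] with s hs
      obtain ⟨θs, hθs⟩ := h.exists_normal ho hconv s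
      have hcos : 0 < cos (arctan (-N s / M s)) := cos_arctan_pos _
      have hsin : sin (arctan (-N s / M s)) = -N s / M s * cos (arctan (-N s / M s)) := by
        rw [← tan_mul_cos hcos.ne', tan_arctan]
      refine hθs.congr (dir_unique (h.normalComp_velocity_eq_zero hn hθs)
        (h.comp_velocity hn hθs).1 ?_ ?_)
      · rw [normalComp_rotate _ θ]
        change N s * cos (Φ s - θ) + M s * sin (Φ s - θ) = 0
        simp only [hΦ, add_sub_cancel_left]
        rw [hsin]
        field_simp
        ring
      · rw [tangentComp_rotate _ θ]
        change 0 < M s * cos (Φ s - θ) - N s * sin (Φ s - θ)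
        simp only [hΦ, add_sub_cancel_left]
        rw [hsin]
        have : M s * cos (arctan (-N s / M s)) - N s * (-N s / M s * cos (arctan (-N s / M s)))
            = cos (arctan (-N s / M s)) * (M s + N s ^ 2 / M s) := by
          field_simp
          ring
        rw [this]
        positivity
    rw [ContinuousAt, hval] at hcont
    rw [hΦT] at hr
    filter_upwards [hr, hcont.eventually hsup] with θ' h1 h2
    change Φ (hΦc.localInverse hΦf hm0 θ') = θ' at h1
    rwa [h1] at h2

end Support

section SupportDeriv

variable {n : WithTop ℕ∞} {γ : Real.Angle → Plane} {Ω : Set Plane}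

theorem IsBoundaryParam.eventually_supportFunction (h : IsBoundaryParam n γ Ω) (hn : 2 ≤ n)
    (ho : IsOpen Ω) (hb : Bornology.IsBounded Ω) (hconv : Convex ℝ Ω) (c : Plane)
    {m : WithTop ℕ∞} (hm : m + 1 ≤ n) (hm1 : 1 ≤ m) {T θ : ℝ} (hT : SupportsAt γ T θ) :
    ContDiffAt ℝ m (supportFunction c Ω) θ ∧
      HasDerivAt (supportFunction c Ω) (tangentComp (γ (T : Real.Angle) - c) θ) θ := by
  obtain ⟨Ψ, hΨT, hΨc, hΨd, hev⟩ := h.exists_local_inverse hn ho hconv hm hm1 hT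
  have heq : supportFunction c Ω =ᶠ[𝓝 θ] fun s => normalComp (γ (Ψ s : Real.Angle) - c) s :=
    hev.mono fun s hs => h.supportFunction_eq ho hb c hs
  have hmn : m ≤ n := le_trans le_self_add hm
  have hcomp : ContDiffAt ℝ m (fun s => γ (Ψ s : Real.Angle)) θ :=
    ((h.contDiff.of_le hmn).contDiffAt).comp θ hΨc
  refine ⟨(contDiffAt_normalComp_comp (hcomp.sub contDiffAt_const) contDiffAt_id).congr_of_eventuallyEq
    heq, HasDerivAt.congr_of_eventuallyEq ?_ heq⟩
  have hg := h.hasDerivAt hn (Ψ θ)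
  have h1 := (hg.scomp θ hΨd).sub_const c
  have h2 := hasDerivAt_normalComp_comp h1 (hasDerivAt_id θ)
  refine h2.congr_deriv ?_
  have h0 := h.normalComp_velocity_eq_zero hn hT
  simp only [Function.comp_apply, id, hΨT, one_mul]
  simp only [normalComp, PiLp.smul_apply, smul_eq_mul] at h0 ⊢
  linear_combination (-(tangentComp (velocity γ (T : Real.Angle)) θ) /
        (velocity (velocity γ) (T : Real.Angle) 0 * cos θ +
          velocity (velocity γ) (T : Real.Angle) 1 * sin θ)) * h0

theorem IsBoundaryParam.hasDerivAt_supportFunction (h : IsBoundaryParam n γ Ω) (hn : 2 ≤ n)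
    (ho : IsOpen Ω) (hb : Bornology.IsBounded Ω) (hconv : Convex ℝ Ω) (c : Plane)
    {T θ : ℝ} (hT : SupportsAt γ T θ) :
    HasDerivAt (supportFunction c Ω) (tangentComp (γ (T : Real.Angle) - c) θ) θ :=
  (h.eventually_supportFunction hn ho hb hconv c
    (by rw [one_add_one_eq_two]; exact hn) le_rfl hT).2

/-- The support function is as smooth as the curve: its derivative is the tangential component of
the support point, which is only one degree of smoothness worse than the curve. The second
derivative gives the radius of curvature `p + p''`. -/
theorem IsBoundaryParam.supportFunction_deriv (h : IsBoundaryParam n γ Ω) (hn : 2 ≤ n)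
    (ho : IsOpen Ω) (hb : Bornology.IsBounded Ω) (hconv : Convex ℝ Ω) (c : Plane)
    {m : WithTop ℕ∞} (hm : m + 1 ≤ n) (hm1 : 1 ≤ m) {T θ : ℝ} (hT : SupportsAt γ T θ) :
    ContDiffAt ℝ m (deriv (supportFunction c Ω)) θ ∧
      HasDerivAt (deriv (supportFunction c Ω))
        (tangentComp (velocity γ (T : Real.Angle)) θ ^ 2 /
          -normalComp (velocity (velocity γ) (T : Real.Angle)) θ - supportFunction c Ω θ) θ := by
  obtain ⟨Ψ, hΨT, hΨc, hΨd, hev⟩ := h.exists_local_inverse hn ho hconv hm hm1 hT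
  have heq : deriv (supportFunction c Ω) =ᶠ[𝓝 θ]
      fun s => tangentComp (γ (Ψ s : Real.Angle) - c) s :=
    hev.mono fun s hs => (h.hasDerivAt_supportFunction hn ho hb hconv c hs).deriv
  have hmn : m ≤ n := le_trans le_self_add hm
  have hcomp : ContDiffAt ℝ m (fun s => γ (Ψ s : Real.Angle)) θ :=
    ((h.contDiff.of_le hmn).contDiffAt).comp θ hΨc
  refine ⟨(contDiffAt_tangentComp_comp (hcomp.sub contDiffAt_const)
    contDiffAt_id).congr_of_eventuallyEq heq, HasDerivAt.congr_of_eventuallyEq ?_ heq⟩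
  have hg := h.hasDerivAt hn (Ψ θ)
  have h1 := (hg.scomp θ hΨd).sub_const c
  have h2 := hasDerivAt_tangentComp_comp h1 (hasDerivAt_id θ)
  refine h2.congr_deriv ?_
  have hν := (h.comp_velocity hn hT).2
  simp only [Function.comp_apply, id, hΨT, one_mul, h.supportFunction_eq ho hb c hT]
  have : ∀ (a : ℝ) (v : Plane), tangentComp (a • v) θ = a * tangentComp v θ := by
    intro a v; simp [tangentComp]; ring
  rw [this]
  have := hν.ne
  field_simp

theorem IsBoundaryParam.contDiff_supportFunction {k : ℕ} (h : IsBoundaryParam k γ Ω) (hk : 2 ≤ k)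
    (ho : IsOpen Ω) (hb : Bornology.IsBounded Ω) (hconv : Convex ℝ Ω) (c : Plane) :
    ContDiff ℝ k (supportFunction c Ω) := by
  obtain ⟨m, rfl⟩ : ∃ m, k = m + 1 := ⟨k - 1, by omega⟩
  have hn : (2 : WithTop ℕ∞) ≤ ((m + 1 : ℕ) : WithTop ℕ∞) := by exact_mod_cast hk
  have hm : (m : WithTop ℕ∞) + 1 ≤ ((m + 1 : ℕ) : WithTop ℕ∞) := by push_cast; exact le_rfl
  have hm1 : (1 : WithTop ℕ∞) ≤ (m : WithTop ℕ∞) := by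
    have : 1 ≤ m := by omega
    exact_mod_cast this
  push_cast
  refine contDiff_succ_iff_deriv.2 ⟨fun θ => ?_, fun h' => absurd h' (by simp), ?_⟩
  · obtain ⟨T, hT⟩ := h.exists_supportsAt θ
    exact (h.hasDerivAt_supportFunction hn ho hb hconv c hT).differentiableAt
  · refine contDiff_iff_contDiffAt.2 fun θ => ?_
    obtain ⟨T, hT⟩ := h.exists_supportsAt θ
    exact (h.supportFunction_deriv hn ho hb hconv c hm hm1 hT).1

/-- The radius of curvature. -/
theorem IsBoundaryParam.supportFunction_curvature (h : IsBoundaryParam n γ Ω) (hn : 2 ≤ n)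
    (ho : IsOpen Ω) (hb : Bornology.IsBounded Ω) (hconv : Convex ℝ Ω) (c : Plane)
    {T θ : ℝ} (hT : SupportsAt γ T θ) :
    supportFunction c Ω θ + deriv (deriv (supportFunction c Ω)) θ =
      tangentComp (velocity γ (T : Real.Angle)) θ ^ 2 /
          -normalComp (velocity (velocity γ) (T : Real.Angle)) θ := by
  rw [(h.supportFunction_deriv hn ho hb hconv c (by rw [one_add_one_eq_two]; exact hn) le_rfl
    hT).2.deriv]
  ring

theorem IsBoundaryParam.supportFunction_curvature_pos (h : IsBoundaryParam n γ Ω) (hn : 2 ≤ n)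
    (ho : IsOpen Ω) (hb : Bornology.IsBounded Ω) (hconv : Convex ℝ Ω) (c : Plane) (θ : ℝ) :
    0 < supportFunction c Ω θ + deriv (deriv (supportFunction c Ω)) θ := by
  obtain ⟨T, hT⟩ := h.exists_supportsAt θ
  rw [h.supportFunction_curvature hn ho hb hconv c hT]
  obtain ⟨h1, h2⟩ := h.comp_velocity hn hT
  exact div_pos (by positivity) (by linarith)

/-! ### Central symmetry -/

theorem pointReflection_sub (c x : Plane) : Equiv.pointReflection c x - c = -(x - c) := by
  rw [Equiv.pointReflection_apply]
  simp only [vsub_eq_sub, vadd_eq_add]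
  abel

theorem normalComp_neg (v : Plane) (θ : ℝ) : normalComp (-v) θ = -normalComp v θ := by
  simp [normalComp]; ring

theorem tangentComp_neg (v : Plane) (θ : ℝ) : tangentComp (-v) θ = -tangentComp v θ := by
  simp [tangentComp]; ring

theorem IsBoundaryParam.supportFunction_add_pi (h : IsBoundaryParam n γ Ω)
    (ho : IsOpen Ω) (hb : Bornology.IsBounded Ω) {c : Plane} (hc : IsCentrallySymmetric Ω c)
    (θ : ℝ) : supportFunction c Ω (θ + π) = supportFunction c Ω θ := by
  have key : ∀ θ, supportFunction c Ω (θ + π) ≤ supportFunction c Ω θ := by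
    intro θ
    obtain ⟨T, hT⟩ := h.exists_supportsAt θ
    obtain ⟨S, hS⟩ := h.exists_supportsAt (θ + π)
    rw [h.supportFunction_eq ho hb c hT, h.supportFunction_eq ho hb c hS, normalComp_add_pi]
    have hmem : Equiv.pointReflection c (γ (S : Real.Angle)) ∈ frontier Ω := by
      rw [← hc]
      exact Set.mem_image_of_mem _ (h.range_eq ▸ Set.mem_range_self _)
    rw [← h.range_eq] at hmem
    obtain ⟨t, ht⟩ := hmem
    have h1 := hT t
    have h2 : normalComp (γ t - c) θ = -normalComp (γ (S : Real.Angle) - c) θ := by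
      rw [ht, pointReflection_sub, normalComp_neg]
    rw [← h2, normalComp_sub, normalComp_sub]
    linarith
  refine le_antisymm (key θ) ?_
  have h1 := key (θ + π)
  have h2 : supportFunction c Ω (θ + π + π) = supportFunction c Ω θ := by
    simp only [SymplecticBilliard.supportFunction_eq]
    simp only [normalComp_add_pi, neg_neg]
  linarith

theorem IsBoundaryParam.supportFunction_pos (h : IsBoundaryParam n γ Ω)
    (ho : IsOpen Ω) (hb : Bornology.IsBounded Ω) {c : Plane} (hc : IsCentrallySymmetric Ω c)
    (θ : ℝ) : 0 < supportFunction c Ω θ := by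
  have h1 := h.supportFunction_add_pi ho hb hc θ
  obtain ⟨T, hT⟩ := h.exists_supportsAt θ
  obtain ⟨S, hS⟩ := h.exists_supportsAt (θ + π)
  obtain ⟨x, hx⟩ : Ω.Nonempty := closure_nonempty_iff.1 ⟨_, h.mem_closure 0⟩
  obtain ⟨y, hy, hlt⟩ := exists_lt_normalComp ho hx θ
  have h2 := h.le_of_mem_closure ho hb hT (subset_closure hy)
  have h3 := h.le_of_mem_closure ho hb hS (subset_closure hx)
  rw [h.supportFunction_eq ho hb c hT, h.supportFunction_eq ho hb c hS] at h1
  rw [h.supportFunction_eq ho hb c hT]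
  simp only [normalComp_add_pi, normalComp_sub] at *
  linarith

end SupportDeriv

/-! ### The domain with a given support function -/

theorem deriv_add_of_periodic {P : ℝ → ℝ} {a : ℝ} (h : ∀ θ, P (θ + a) = P θ) (θ : ℝ) :
    deriv P (θ + a) = deriv P θ := by
  rw [← deriv_comp_add_const, funext h]

/-- The point with outer normal `(cos θ, sin θ)` on the boundary of the domain whose support
function with respect to `c` is `P`. -/
noncomputable def envelope (c : Plane) (P : ℝ → ℝ) (θ : ℝ) : Plane :=
  c + !₂[P θ * cos θ - deriv P θ * sin θ, P θ * sin θ + deriv P θ * cos θ]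

/-- The closed curve `envelope c P`, for a `2π`-periodic function `P`. -/
noncomputable def envelopeCurve (c : Plane) (P : ℝ → ℝ) (t : Real.Angle) : Plane :=
  envelope c P t.toReal

/-- The intersection of the open half-planes `⟨x - c, (cos θ, sin θ)⟩ < P θ`. -/
def supportDomain (c : Plane) (P : ℝ → ℝ) : Set Plane :=
  {x | ∀ θ, normalComp (x - c) θ < P θ}

section Envelope

variable (c : Plane) {P : ℝ → ℝ}

theorem normalComp_envelope (P : ℝ → ℝ) (s θ : ℝ) :
    normalComp (envelope c P s - c) θ = P s * cos (s - θ) - deriv P s * sin (s - θ) := by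
  simp [normalComp, envelope, cos_sub, sin_sub]; ring

theorem tangentComp_envelope (P : ℝ → ℝ) (s θ : ℝ) :
    tangentComp (envelope c P s - c) θ = P s * sin (s - θ) + deriv P s * cos (s - θ) := by
  simp [tangentComp, envelope, cos_sub, sin_sub]; ring

theorem normalComp_envelope_self (P : ℝ → ℝ) (θ : ℝ) :
    normalComp (envelope c P θ - c) θ = P θ := by simp [normalComp_envelope]

theorem tangentComp_envelope_self (P : ℝ → ℝ) (θ : ℝ) :
    tangentComp (envelope c P θ - c) θ = deriv P θ := by simp [tangentComp_envelope]

theorem eq_envelope_of_comp {c x : Plane} {θ : ℝ} (h : normalComp (x - c) θ = P θ)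
    (h' : tangentComp (x - c) θ = deriv P θ) : x = envelope c P θ := by
  have : x - c = envelope c P θ - c :=
    eq_of_comp_eq (θ := θ) (by rw [h, normalComp_envelope_self])
      (by rw [h', tangentComp_envelope_self])
  exact sub_left_injective this

theorem envelope_congr (h2 : ∀ θ, P (θ + 2 * π) = P θ) {s s' : ℝ}
    (hs : (s : Real.Angle) = s') : envelope c P s = envelope c P s' := by
  obtain ⟨k, hk⟩ := Real.Angle.angle_eq_iff_two_pi_dvd_sub.1 hs
  have hP : Function.Periodic P (2 * π) := h2
  have hP' : Function.Periodic (deriv P) (2 * π) := deriv_add_of_periodic h2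
  have e1 := congrArg Real.Angle.cos hs
  have e2 := congrArg Real.Angle.sin hs
  simp only [Real.Angle.cos_coe, Real.Angle.sin_coe] at e1 e2
  have hs' : s = s' + k * (2 * π) := by linarith
  have e3 : P s = P s' := by rw [hs']; exact hP.int_mul k s'
  have e4 : deriv P s = deriv P s' := by rw [hs']; exact hP'.int_mul k s'
  simp only [envelope, e1, e2, e3, e4]

theorem envelopeCurve_coe (h2 : ∀ θ, P (θ + 2 * π) = P θ) (s : ℝ) :
    envelopeCurve c P (s : Real.Angle) = envelope c P s :=
  envelope_congr c h2 (Real.Angle.coe_toReal _)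

theorem two_pi_periodic (hπ : ∀ θ, P (θ + π) = P θ) (θ : ℝ) : P (θ + 2 * π) = P θ := by
  rw [two_mul, ← add_assoc, hπ, hπ]

theorem hasDerivAt_normalComp_envelope (hP : ContDiff ℝ 2 P) (θ s : ℝ) :
    HasDerivAt (fun s => normalComp (envelope c P s - c) θ)
      (-((P s + deriv (deriv P) s) * sin (s - θ))) s := by
  have h1 : HasDerivAt P (deriv P s) s := (hP.differentiable (by simp) s).hasDerivAt
  have hP' : ContDiff ℝ 1 (deriv P) := (contDiff_succ_iff_deriv (n := 1)).1
    (by rw [one_add_one_eq_two]; exact hP) |>.2.2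
  have h2 : HasDerivAt (deriv P) (deriv (deriv P) s) s :=
    (hP'.differentiable (by simp) s).hasDerivAt
  have h3 : HasDerivAt (fun s => s - θ) 1 s := (hasDerivAt_id s).sub_const θ
  simp only [normalComp_envelope]
  refine ((h1.mul h3.cos).sub (h2.mul h3.sin)).congr_deriv ?_
  ring

/-- The height in a fixed direction decreases strictly along the half of the curve that leads from
the support point to the antipodal one. -/
theorem strictAntiOn_normalComp_envelope (hP : ContDiff ℝ 2 P)
    (hρ : ∀ θ, 0 < P θ + deriv (deriv P) θ) (θ : ℝ) :
    StrictAntiOn (fun s => normalComp (envelope c P s - c) θ) (Set.Icc θ (θ + π)) := by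
  refine strictAntiOn_of_deriv_neg (convex_Icc _ _) (fun s _ =>
    (hasDerivAt_normalComp_envelope c hP θ s).continuousAt.continuousWithinAt) fun s hs => ?_
  rw [interior_Icc] at hs
  rw [(hasDerivAt_normalComp_envelope c hP θ s).deriv]
  have := sin_pos_of_pos_of_lt_pi (x := s - θ) (by linarith [hs.1]) (by linarith [hs.2])
  have := mul_pos (hρ s) this
  linarith

theorem strictMonoOn_normalComp_envelope (hP : ContDiff ℝ 2 P)
    (hρ : ∀ θ, 0 < P θ + deriv (deriv P) θ) (θ : ℝ) :
    StrictMonoOn (fun s => normalComp (envelope c P s - c) θ) (Set.Icc (θ - π) θ) := by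
  refine strictMonoOn_of_deriv_pos (convex_Icc _ _) (fun s _ =>
    (hasDerivAt_normalComp_envelope c hP θ s).continuousAt.continuousWithinAt) fun s hs => ?_
  rw [interior_Icc] at hs
  rw [(hasDerivAt_normalComp_envelope c hP θ s).deriv]
  have := sin_neg_of_neg_of_neg_pi_lt (x := s - θ) (by linarith [hs.2]) (by linarith [hs.1])
  have := mul_neg_of_pos_of_neg (hρ s) this
  linarith

/-- A representative of an angle in the interval of length `2π` around a given number. -/
theorem exists_rep_near (s θ : ℝ) :
    ∃ s' : ℝ, (s' : Real.Angle) = s ∧ θ - π < s' ∧ s' ≤ θ + π := by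
  refine ⟨θ + ((s - θ : ℝ) : Real.Angle).toReal, ?_, ?_, ?_⟩
  · simp
  · linarith [Real.Angle.neg_pi_lt_toReal ((s - θ : ℝ) : Real.Angle)]
  · linarith [Real.Angle.toReal_le_pi ((s - θ : ℝ) : Real.Angle)]

theorem normalComp_envelope_lt (hP : ContDiff ℝ 2 P) (h2 : ∀ θ, P (θ + 2 * π) = P θ)
    (hρ : ∀ θ, 0 < P θ + deriv (deriv P) θ) {s θ : ℝ} (hne : (s : Real.Angle) ≠ θ) :
    normalComp (envelope c P s - c) θ < P θ := by
  obtain ⟨s', hs', h1, h3⟩ := exists_rep_near s θ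
  rw [← envelope_congr c h2 hs', ← normalComp_envelope_self c P θ]
  have hne' : s' ≠ θ := by rintro rfl; exact hne hs'.symm
  have hpi := pi_pos
  rcases lt_or_gt_of_ne hne' with hlt | hgt
  · exact strictMonoOn_normalComp_envelope c hP hρ θ ⟨h1.le, hlt.le⟩ ⟨by linarith, le_rfl⟩ hlt
  · exact strictAntiOn_normalComp_envelope c hP hρ θ ⟨le_rfl, by linarith⟩ ⟨hgt.le, h3⟩ hgt

theorem normalComp_envelope_le (hP : ContDiff ℝ 2 P) (h2 : ∀ θ, P (θ + 2 * π) = P θ)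
    (hρ : ∀ θ, 0 < P θ + deriv (deriv P) θ) (s θ : ℝ) :
    normalComp (envelope c P s - c) θ ≤ P θ := by
  by_cases h : (s : Real.Angle) = θ
  · rw [envelope_congr c h2 h, normalComp_envelope_self]
  · exact (normalComp_envelope_lt c hP h2 hρ h).le

/-! ### The domain is strongly convex -/

theorem isOpen_supportDomain (hP : Continuous P) (h2 : ∀ θ, P (θ + 2 * π) = P θ) :
    IsOpen (supportDomain c P) := by
  have heq : supportDomain c P =
      {x | ∀ θ ∈ Set.Icc (-π) π, normalComp (x - c) θ < P θ} := by
    ext x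
    refine ⟨fun hx θ _ => hx θ, fun hx θ => ?_⟩
    have hmem : (θ : Real.Angle).toReal ∈ Set.Icc (-π) π :=
      ⟨(Real.Angle.neg_pi_lt_toReal _).le, Real.Angle.toReal_le_pi _⟩
    have hang : ((θ : Real.Angle).toReal : Real.Angle) = θ := Real.Angle.coe_toReal _
    have := hx _ hmem
    obtain ⟨k, hk⟩ := Real.Angle.angle_eq_iff_two_pi_dvd_sub.1 hang
    have hPk : P (θ : Real.Angle).toReal = P θ := by
      have hs' : (θ : Real.Angle).toReal = θ + k * (2 * π) := by linarith
      rw [hs']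
      exact (show Function.Periodic P (2 * π) from h2).int_mul k θ
    rwa [normalComp_congr hang, hPk] at this
  rw [heq, isOpen_iff_eventually]
  intro x hx
  refine isCompact_Icc.eventually_forall_of_forall_eventually fun θ hθ => ?_
  have hc : Continuous fun q : Plane × ℝ => normalComp (q.1 - c) q.2 :=
    continuous_normalComp.comp ((continuous_fst.sub continuous_const).prodMk continuous_snd)
  exact (isOpen_lt hc (hP.comp continuous_snd)).mem_nhds (hx θ hθ)

theorem convex_supportDomain : Convex ℝ (supportDomain c P) := by
  intro x hx y hy a b ha hb hab θ
  have h1 := hx θ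
  have h2 := hy θ
  have e : normalComp (a • x + b • y - c) θ
      = a * normalComp (x - c) θ + b * normalComp (y - c) θ := by
    simp [normalComp]
    linear_combination (c 0 * cos θ + c 1 * sin θ) * hab
  rw [e]
  rcases ha.eq_or_lt with rfl | ha'
  · have hb1 : b = 1 := by linarith
    subst hb1
    linarith
  · have e1 := mul_lt_mul_of_pos_left h1 ha'
    have e2 := mul_le_mul_of_nonneg_left h2.le hb
    have e3 : P θ = a * P θ + b * P θ := by rw [← add_mul, hab, one_mul]
    linarith

theorem isBounded_supportDomain (P : ℝ → ℝ) :
    Bornology.IsBounded (supportDomain c P) := by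
  set C := |P 0| + |P π| + |P (π / 2)| + |P (-(π / 2))| with hC
  refine (Metric.isBounded_closedBall (x := c) (r := 2 * C)).subset fun x hx => ?_
  rw [Metric.mem_closedBall, dist_eq_norm, EuclideanSpace.norm_eq]
  have b1 := hx 0
  have b2 := hx π
  have b3 := hx (π / 2)
  have b4 := hx (-(π / 2))
  have c1 := le_abs_self (P 0)
  have a1 := abs_nonneg (P 0)
  have c2 := le_abs_self (P π)
  have a2 := abs_nonneg (P π)
  have c3 := le_abs_self (P (π / 2))
  have a3 := abs_nonneg (P (π / 2))
  have c4 := le_abs_self (P (-(π / 2)))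
  have a4 := abs_nonneg (P (-(π / 2)))
  simp [normalComp] at b1 b2 b3 b4
  have hC0 : 0 ≤ C := by linarith
  rw [sqrt_le_left (by positivity)]
  simp only [Fin.sum_univ_two, Real.norm_eq_abs, sq_abs, PiLp.sub_apply]
  have d1 : (x 0 - c 0) ^ 2 ≤ C ^ 2 := sq_le_sq' (by linarith) (by linarith)
  have d2 : (x 1 - c 1) ^ 2 ≤ C ^ 2 := sq_le_sq' (by linarith) (by linarith)
  nlinarith

theorem closure_supportDomain_subset : closure (supportDomain c P) ⊆
    {x | ∀ θ, normalComp (x - c) θ ≤ P θ} := by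
  have hcl : IsClosed {x : Plane | ∀ θ, normalComp (x - c) θ ≤ P θ} := by
    simp only [Set.ofPred_forall]
    refine isClosed_iInter fun θ => isClosed_le ?_ continuous_const
    exact continuous_normalComp.comp ((continuous_id.sub continuous_const).prodMk continuous_const)
  exact closure_minimal (fun x hx θ => (hx θ).le) hcl

theorem shrink_mem_supportDomain (hpos : ∀ θ, 0 < P θ) {x : Plane}
    (hx : ∀ θ, normalComp (x - c) θ ≤ P θ) {a : ℝ} (ha0 : 0 ≤ a) (ha : a < 1) :
    c + a • (x - c) ∈ supportDomain c P := by
  intro θ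
  have e : normalComp (c + a • (x - c) - c) θ = a * normalComp (x - c) θ := by
    simp [normalComp]; ring
  rw [e]
  have := mul_le_mul_of_nonneg_left (hx θ) ha0
  have := mul_lt_mul_of_pos_right ha (hpos θ)
  linarith

theorem mem_closure_supportDomain (hpos : ∀ θ, 0 < P θ) {x : Plane}
    (hx : ∀ θ, normalComp (x - c) θ ≤ P θ) : x ∈ closure (supportDomain c P) := by
  have hcont : ContinuousWithinAt (fun a : ℝ => c + a • (x - c)) (Set.Ico 0 1) 1 := by
    fun_prop
  have h1 : (1 : ℝ) ∈ closure (Set.Ico (0 : ℝ) 1) := by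
    rw [closure_Ico zero_ne_one]; simp
  have := hcont.mem_closure h1
    (fun a ha => shrink_mem_supportDomain c hpos hx ha.1 ha.2)
  simpa using this

theorem frontier_supportDomain (hP : ContDiff ℝ 2 P) (h2 : ∀ θ, P (θ + 2 * π) = P θ)
    (hpos : ∀ θ, 0 < P θ) (hρ : ∀ θ, 0 < P θ + deriv (deriv P) θ) :
    frontier (supportDomain c P) = Set.range (envelopeCurve c P) := by
  rw [(isOpen_supportDomain c hP.continuous h2).frontier_eq]
  ext x
  constructor
  · rintro ⟨hx, hx'⟩
    have hle := closure_supportDomain_subset c hx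
    obtain ⟨θ, hθ⟩ : ∃ θ, P θ ≤ normalComp (x - c) θ := by
      simpa [supportDomain] using hx'
    have heq : normalComp (x - c) θ = P θ := le_antisymm (hle θ) hθ
    -- `P - ⟨x - c, ·⟩` has a minimum at `θ`, so its derivative vanishes there
    have hmin : IsLocalMin (fun s => P s - normalComp (x - c) s) θ :=
      Eventually.of_forall fun s => by
        have := hle s
        simp only [heq, sub_self]
        linarith
    have hd1 : HasDerivAt P (deriv P θ) θ := (hP.differentiable (by simp) θ).hasDerivAt
    have hd2 := hasDerivAt_normalComp_comp (hasDerivAt_const θ (x - c)) (hasDerivAt_id θ)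
    have h0 := hmin.hasDerivAt_eq_zero (hd1.sub hd2)
    have hn0 : normalComp 0 θ = 0 := by simp [normalComp]
    simp only [id, hn0, one_mul, zero_add] at h0
    refine ⟨(θ : Real.Angle), ?_⟩
    rw [envelopeCurve_coe c h2]
    exact (eq_envelope_of_comp heq (by linarith)).symm
  · rintro ⟨t, rfl⟩
    refine ⟨mem_closure_supportDomain c hpos fun θ => normalComp_envelope_le c hP h2 hρ _ θ, ?_⟩
    intro hmem
    have := hmem t.toReal
    rw [envelopeCurve, normalComp_envelope_self] at this
    exact lt_irrefl _ this

theorem supportFunction_supportDomain (hP : ContDiff ℝ 2 P) (h2 : ∀ θ, P (θ + 2 * π) = P θ)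
    (hpos : ∀ θ, 0 < P θ) (hρ : ∀ θ, 0 < P θ + deriv (deriv P) θ) :
    supportFunction c (supportDomain c P) = P := by
  ext θ
  rw [supportFunction_eq]
  have hc : c ∈ supportDomain c P := fun θ => by simpa [normalComp] using hpos θ
  refine IsLUB.csSup_eq ⟨?_, ?_⟩ (Set.Nonempty.image _ ⟨c, hc⟩)
  · rintro _ ⟨x, hx, rfl⟩
    exact (hx θ).le
  · intro b hub
    have hcont : Continuous fun v : Plane => normalComp (v - c) θ :=
      continuous_normalComp.comp ((continuous_id.sub continuous_const).prodMk continuous_const)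
    have hcl : closure (supportDomain c P) ⊆ {v | normalComp (v - c) θ ≤ b} :=
      closure_minimal (fun x hx => hub ⟨x, hx, rfl⟩) (isClosed_le hcont continuous_const)
    have := hcl (mem_closure_supportDomain c hpos
      fun φ => normalComp_envelope_le c hP h2 hρ θ φ)
    simpa [normalComp_envelope_self] using this

theorem envelope_add_pi_sub (hπ : ∀ θ, P (θ + π) = P θ) (s : ℝ) :
    envelope c P (s + π) - c = -(envelope c P s - c) := by
  refine eq_of_comp_eq (θ := s) ?_ ?_
  · rw [normalComp_neg, normalComp_envelope, normalComp_envelope, hπ, deriv_add_of_periodic hπ]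
    simp
  · rw [tangentComp_neg, tangentComp_envelope, tangentComp_envelope, hπ, deriv_add_of_periodic hπ]
    simp

theorem isCentrallySymmetric_supportDomain (hP : ContDiff ℝ 2 P) (hπ : ∀ θ, P (θ + π) = P θ)
    (hpos : ∀ θ, 0 < P θ) (hρ : ∀ θ, 0 < P θ + deriv (deriv P) θ) :
    IsCentrallySymmetric (supportDomain c P) c := by
  have h2 := two_pi_periodic hπ
  have hrefl : ∀ s, Equiv.pointReflection c (envelope c P s) = envelope c P (s + π) := by
    intro s
    have h : Equiv.pointReflection c (envelope c P s) - c = envelope c P (s + π) - c := by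
      rw [pointReflection_sub, envelope_add_pi_sub c hπ]
    exact sub_left_injective h
  rw [IsCentrallySymmetric, frontier_supportDomain c hP h2 hpos hρ]
  ext x
  constructor
  · rintro ⟨_, ⟨t, rfl⟩, rfl⟩
    refine ⟨((t.toReal + π : ℝ) : Real.Angle), ?_⟩
    rw [envelopeCurve_coe c h2, envelopeCurve, hrefl]
  · rintro ⟨t, rfl⟩
    refine ⟨envelopeCurve c P ((t.toReal + π : ℝ) : Real.Angle), Set.mem_range_self _, ?_⟩
    rw [envelopeCurve_coe c h2, hrefl, envelopeCurve]
    refine envelope_congr c h2 ?_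
    rw [Real.Angle.coe_add, Real.Angle.coe_add, add_assoc, Real.Angle.coe_pi_add_coe_pi, add_zero]

theorem hasDerivAt_envelope (hP : ContDiff ℝ 2 P) (θ : ℝ) :
    HasDerivAt (envelope c P) ((P θ + deriv (deriv P) θ) • !₂[-sin θ, cos θ]) θ := by
  have h1 : HasDerivAt P (deriv P θ) θ := (hP.differentiable (by simp) θ).hasDerivAt
  have hP' : ContDiff ℝ 1 (deriv P) := (contDiff_succ_iff_deriv (n := 1)).1
    (by rw [one_add_one_eq_two]; exact hP) |>.2.2
  have h2 : HasDerivAt (deriv P) (deriv (deriv P) θ) θ :=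
    (hP'.differentiable (by simp) θ).hasDerivAt
  rw [hasDerivAt_iff_hasFDerivAt, ← hasFDerivWithinAt_univ, hasFDerivWithinAt_euclidean]
  intro i
  rw [hasFDerivWithinAt_univ]
  fin_cases i
  · refine HasFDerivAt.congr_fderiv
      ((((h1.mul (hasDerivAt_cos θ)).sub (h2.mul (hasDerivAt_sin θ))).const_add (c 0)).hasFDerivAt) ?_
    ext
    simp
    ring
  · refine HasFDerivAt.congr_fderiv
      ((((h1.mul (hasDerivAt_sin θ)).add (h2.mul (hasDerivAt_cos θ))).const_add (c 1)).hasFDerivAt) ?_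
    ext
    simp
    ring

theorem isBoundaryParam_envelopeCurve (hP : ContDiff ℝ ∞ P) (h2 : ∀ θ, P (θ + 2 * π) = P θ)
    (hpos : ∀ θ, 0 < P θ) (hρ : ∀ θ, 0 < P θ + deriv (deriv P) θ) :
    IsBoundaryParam ∞ (envelopeCurve c P) (supportDomain c P) := by
  have hP2 : ContDiff ℝ 2 P := by exact_mod_cast contDiff_infty.1 hP 2
  have hP' : ContDiff ℝ ∞ (deriv P) := (contDiff_infty_iff_deriv.1 hP).2
  have hP'' : ContDiff ℝ ∞ (deriv (deriv P)) := (contDiff_infty_iff_deriv.1 hP').2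
  have hcurve : (fun s : ℝ => envelopeCurve c P (s : Real.Angle)) = envelope c P :=
    funext fun s => envelopeCurve_coe c h2 s
  have hvel : ∀ s : ℝ, velocity (envelopeCurve c P) (s : Real.Angle)
      = (P s + deriv (deriv P) s) • !₂[-sin s, cos s] := by
    intro s
    rw [velocity_coe, hcurve, (hasDerivAt_envelope c hP2 s).deriv]
  have hnv : ∀ s θ : ℝ, normalComp (velocity (envelopeCurve c P) (s : Real.Angle)) θ
      = -((P s + deriv (deriv P) s) * sin (s - θ)) := by
    intro s θ
    rw [hvel]; simp [normalComp, sin_sub]; ring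
  have htv : ∀ s : ℝ, tangentComp (velocity (envelopeCurve c P) (s : Real.Angle)) s
      = P s + deriv (deriv P) s := by
    intro s
    rw [hvel]; simp [tangentComp]
    linear_combination (P s + deriv (deriv P) s) * sin_sq_add_cos_sq s
  refine ⟨?_, ?_, ?_, ?_, ?_⟩
  · rw [hcurve, contDiff_euclidean]
    intro i
    fin_cases i
    · exact contDiff_const.add ((hP.mul contDiff_cos).sub (hP'.mul contDiff_sin))
    · exact contDiff_const.add ((hP.mul contDiff_sin).add (hP'.mul contDiff_cos))
  · intro t t' heq
    by_contra hne
    have := normalComp_envelope_lt c hP2 h2 hρ (s := t.toReal) (θ := t'.toReal) (by simpa using hne)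
    rw [envelopeCurve, envelopeCurve] at heq
    rw [heq, normalComp_envelope_self] at this
    exact lt_irrefl _ this
  · exact (frontier_supportDomain c hP2 h2 hpos hρ).symm
  · intro t h0
    have := htv t.toReal
    rw [Real.Angle.coe_toReal, h0] at this
    have h3 := hρ t.toReal
    simp [tangentComp] at this
    linarith
  · intro t
    set s := t.toReal with hs
    have hts : t = (s : Real.Angle) := (Real.Angle.coe_toReal t).symm
    have hdiff : HasDerivAt (fun u : ℝ => velocity (envelopeCurve c P) (u : Real.Angle))
        (velocity (velocity (envelopeCurve c P)) (s : Real.Angle)) s := by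
      rw [velocity_coe]
      refine DifferentiableAt.hasDerivAt ?_
      rw [show (fun u : ℝ => velocity (envelopeCurve c P) (u : Real.Angle))
        = fun u => (P u + deriv (deriv P) u) • !₂[-sin u, cos u] from funext hvel,
        differentiableAt_euclidean]
      have hd : DifferentiableAt ℝ (fun u => P u + deriv (deriv P) u) s :=
        ((hP.add hP'').differentiable (by simp)) s
      intro i
      fin_cases i
      · exact hd.mul differentiable_sin.neg.differentiableAt
      · exact hd.mul differentiable_cos.differentiableAt
    have hN := hasDerivAt_normalComp_comp hdiff (hasDerivAt_const s s)
    have hN' : HasDerivAt (fun u : ℝ => normalComp (velocity (envelopeCurve c P) (u : Real.Angle)) s)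
        (-(P s + deriv (deriv P) s)) s := by
      simp only [hnv]
      have hd : HasDerivAt (fun u => P u + deriv (deriv P) u)
          (deriv (fun u => P u + deriv (deriv P) u) s) s :=
        (((hP.add hP'').differentiable (by simp)) s).hasDerivAt
      refine ((hd.mul (((hasDerivAt_id s).sub_const s).sin)).neg).congr_deriv ?_
      simp
    have hval := hN.unique hN'
    have hn0 : normalComp (velocity (envelopeCurve c P) (s : Real.Angle)) s = 0 := by
      rw [hnv]; simp
    rw [hts, det_eq_neg_of_normalComp_eq_zero hn0, htv]
    have h3 := hρ s
    have h4 : normalComp (velocity (velocity (envelopeCurve c P)) (s : Real.Angle)) s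
        = -(P s + deriv (deriv P) s) := by linarith
    rw [h4]
    nlinarith

theorem isStronglyConvexDomain_supportDomain (hP : ContDiff ℝ ∞ P)
    (h2 : ∀ θ, P (θ + 2 * π) = P θ) (hpos : ∀ θ, 0 < P θ)
    (hρ : ∀ θ, 0 < P θ + deriv (deriv P) θ) :
    IsStronglyConvexDomain ∞ (supportDomain c P) :=
  ⟨isOpen_supportDomain c hP.continuous h2, isBounded_supportDomain c P,
    convex_supportDomain c, _, isBoundaryParam_envelopeCurve c hP h2 hpos hρ⟩

end Envelope

/-! ### Smooth approximation of periodic functions -/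

theorem uniformContinuous_of_periodic {f : ℝ → ℝ} {a : ℝ} (ha : 0 < a)
    (hf : Continuous f) (hper : Function.Periodic f a) : UniformContinuous f := by
  rw [Metric.uniformContinuous_iff]
  intro ε hε
  have hK := (isCompact_Icc (a := -a) (b := 2 * a)).uniformContinuousOn_of_continuous
    hf.continuousOn
  obtain ⟨δ, hδ, h⟩ := Metric.uniformContinuousOn_iff.1 hK ε hε
  refine ⟨min δ a, lt_min hδ ha, fun {x y} hxy => ?_⟩
  set n := toIcoDiv ha 0 x with hn
  have hx := sub_toIcoDiv_zsmul_mem_Ico ha 0 x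
  rw [← hn, zero_add, zsmul_eq_mul] at hx
  rw [dist_eq, lt_min_iff] at hxy
  have h2 := abs_lt.1 hxy.2
  have key := h (x - n * a) ⟨by linarith [hx.1], by linarith [hx.2]⟩ (y - n * a)
    ⟨by linarith [hx.1], by linarith [hx.2]⟩ (by rw [dist_eq]; simpa using hxy.1)
  rwa [hper.sub_int_mul_eq, hper.sub_int_mul_eq] at key

open MeasureTheory Convolution in
theorem exists_smooth_periodic_approx {f : ℝ → ℝ} {a : ℝ} (ha : 0 < a) (hf : Continuous f)
    (hper : Function.Periodic f a) {ε : ℝ} (hε : 0 < ε) :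
    ∃ g : ℝ → ℝ, ContDiff ℝ ∞ g ∧ Function.Periodic g a ∧ ∀ x, |f x - g x| ≤ ε := by
  obtain ⟨δ, hδ, h⟩ := Metric.uniformContinuous_iff.1 (uniformContinuous_of_periodic ha hf hper) ε hε
  set φ : ContDiffBump (0 : ℝ) := ⟨δ / 2, δ, half_pos hδ, half_lt_self hδ⟩
  refine ⟨φ.normed volume ⋆[ContinuousLinearMap.lsmul ℝ ℝ, volume] f, ?_, ?_, ?_⟩
  · exact φ.hasCompactSupport_normed.contDiff_convolution_left _ φ.contDiff_normed
      hf.locallyIntegrable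
  · intro x
    simp only [convolution_def]
    congr 1
    ext t
    rw [show x + a - t = (x - t) + a by ring, hper]
  · intro x
    have := φ.dist_normed_convolution_le (μ := volume) (x₀ := x) (ε := ε) hf.aestronglyMeasurable
      (fun y hy => (h (Metric.mem_ball.1 hy)).le)
    rwa [dist_comm, dist_eq] at this

theorem iteratedDeriv_sub_const (j : ℕ) (f : ℝ → ℝ) (m : ℝ) :
    iteratedDeriv (j + 1) (fun x => f x - m) = iteratedDeriv (j + 1) f := by
  rw [iteratedDeriv_succ', iteratedDeriv_succ']
  congr 1
  ext x
  exact deriv_sub_const m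

/-- Smooth periodic functions are dense among the periodic functions of class `C^k`. The step from
`k` to `k + 1` integrates an approximation of the derivative, corrected to have mean value `0`. -/
theorem exists_smooth_periodic_approx_of_contDiff {a : ℝ} (ha : 0 < a) (k : ℕ) :
    ∀ (f : ℝ → ℝ), ContDiff ℝ k f → Function.Periodic f a → ∀ ε : ℝ, 0 < ε →
    ∃ g : ℝ → ℝ, ContDiff ℝ ∞ g ∧ Function.Periodic g a ∧
      ∀ j ≤ k, ∀ x, |iteratedDeriv j f x - iteratedDeriv j g x| ≤ ε := by
  induction k with
  | zero =>
    intro f hf hper ε hε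
    obtain ⟨g, h1, h2, h3⟩ := exists_smooth_periodic_approx ha hf.continuous hper hε
    refine ⟨g, h1, h2, fun j hj x => ?_⟩
    obtain rfl : j = 0 := by omega
    simpa using h3 x
  | succ k ih =>
    intro f hf hper ε hε
    obtain ⟨hfd, -, hf'⟩ := contDiff_succ_iff_deriv.1 (by exact_mod_cast hf :
      ContDiff ℝ ((k : WithTop ℕ∞) + 1) f)
    have hper' : Function.Periodic (deriv f) a := deriv_add_of_periodic hper
    set η := ε / (2 * (1 + a)) with hη
    have hη0 : 0 < η := by positivity
    have hηε : 2 * η * (1 + a) = ε := by rw [hη]; field_simp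
    obtain ⟨q, hq, hqp, hqa⟩ := ih (deriv f) hf' hper' η hη0
    have hqc : Continuous q := hq.continuous
    have hq0 : ∀ x, |deriv f x - q x| ≤ η := fun x => by simpa using hqa 0 (by omega) x
    set m := (∫ x in (0 : ℝ)..a, q x) / a with hm
    have hf'c : Continuous (deriv f) := hf'.continuous
    have hfint : ∫ x in (0 : ℝ)..a, deriv f x = 0 := by
      rw [intervalIntegral.integral_deriv_eq_sub (fun x _ => hfd x)
        (hf'c.intervalIntegrable _ _)]
      have := hper 0
      rw [zero_add] at this
      rw [this, sub_self]
    have hmle : |m| ≤ η := by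
      have h1 : ∫ x in (0 : ℝ)..a, q x = -∫ x in (0 : ℝ)..a, (deriv f x - q x) := by
        rw [intervalIntegral.integral_sub (hf'c.intervalIntegrable _ _)
          (hqc.intervalIntegrable _ _), hfint]
        ring
      have h2 := intervalIntegral.norm_integral_le_of_norm_le_const (a := 0) (b := a) (C := η)
        (f := fun x => deriv f x - q x) (fun x _ => hq0 x)
      rw [hm, h1, abs_div, abs_neg, abs_of_pos ha, div_le_iff₀ ha]
      simpa [abs_of_pos ha] using h2
    set r : ℝ → ℝ := fun x => q x - m with hr
    have hrc : Continuous r := hqc.sub continuous_const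
    have hrs : ContDiff ℝ ∞ r := hq.sub contDiff_const
    have hrp : Function.Periodic r a := fun x => by simp only [hr, hqp x]
    have hrint : ∫ x in (0 : ℝ)..a, r x = 0 := by
      rw [hr, intervalIntegral.integral_sub (hqc.intervalIntegrable _ _)
        (continuous_const.intervalIntegrable _ _), hm]
      simp
      field_simp
      ring
    set g : ℝ → ℝ := fun x => f 0 + ∫ t in (0 : ℝ)..x, r t with hg
    have hgd : ∀ x, HasDerivAt g (r x) x := fun x =>
      ((hrc.integral_hasStrictDerivAt 0 x).hasDerivAt).const_add _
    have hgd' : deriv g = r := funext fun x => (hgd x).deriv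
    have hgper : Function.Periodic g a := by
      intro x
      have h1 : ∫ t in (0 : ℝ)..(x + a), r t
          = (∫ t in (0 : ℝ)..x, r t) + ∫ t in x..(x + a), r t :=
        (intervalIntegral.integral_add_adjacent_intervals (hrc.intervalIntegrable _ _)
          (hrc.intervalIntegrable _ _)).symm
      have h2 := hrp.intervalIntegral_add_eq x 0
      rw [zero_add, hrint] at h2
      simp only [hg]
      rw [h1, h2, add_zero]
    have hfr : ∀ x, |deriv f x - r x| ≤ 2 * η := by
      intro x
      have h1 := abs_le.1 (hq0 x)
      have h2 := abs_le.1 hmle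
      rw [abs_le]
      simp only [hr]
      constructor <;> linarith
    have h2η : 2 * η ≤ ε := by rw [← hηε]; nlinarith
    refine ⟨g, contDiff_infty_iff_deriv.2 ⟨fun x => (hgd x).differentiableAt, hgd' ▸ hrs⟩,
      hgper, fun j hj x => ?_⟩
    rcases j with _ | j
    · -- the mean value inequality on one period
      simp only [iteratedDeriv_zero]
      have hD : Function.Periodic (fun x => f x - g x) a := fun x => by
        simp only [hper x, hgper x]
      obtain ⟨y, hy, hxy⟩ := hD.exists_mem_Ico₀ ha x
      rw [hxy]
      have hder : ∀ z, HasDerivAt (fun x => f x - g x) (deriv f z - r z) z := fun z =>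
        (hfd z).hasDerivAt.sub (hgd z)
      have := Convex.norm_image_sub_le_of_norm_deriv_le (f := fun x => f x - g x) (C := 2 * η)
        (s := Set.univ) (x := 0) (y := y) (fun z _ => (hder z).differentiableAt)
        (fun z _ => by rw [(hder z).deriv]; exact hfr z) convex_univ trivial trivial
      have hg0 : f 0 - g 0 = 0 := by simp [hg]
      rw [hg0, sub_zero, sub_zero, Real.norm_eq_abs, Real.norm_eq_abs, abs_of_nonneg hy.1] at this
      refine this.trans ?_
      rw [← hηε]
      have := hy.2
      nlinarith
    · rw [iteratedDeriv_succ', iteratedDeriv_succ', hgd']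
      rcases j with _ | j
      · simpa using (hfr x).trans h2η
      · rw [hr, iteratedDeriv_sub_const]
        exact (hqa (j + 1) (by omega) x).trans (by linarith)

/-! ### Smooth families of functions -/

section Family

variable {E : Type*} [NormedAddCommGroup E] [NormedSpace ℝ E]

theorem contDiff_iteratedDeriv_of_family {G : E → ℝ → ℝ}
    (hG : ContDiff ℝ ∞ fun q : E × ℝ => G q.1 q.2) (j : ℕ) :
    ContDiff ℝ ∞ fun q : E × ℝ => iteratedDeriv j (G q.1) q.2 := by
  induction j with
  | zero => simpa using hG
  | succ j ih =>
    have h1 : (fun q : E × ℝ => iteratedDeriv (j + 1) (G q.1) q.2)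
        = fun q => fderiv ℝ (fun q : E × ℝ => iteratedDeriv j (G q.1) q.2) q (0, 1) := by
      ext ⟨e, x⟩
      rw [iteratedDeriv_succ]
      have hd := (ih.differentiable (by simp) (e, x)).hasFDerivAt
      have hc : HasDerivAt (fun s : ℝ => ((e, s) : E × ℝ)) (0, 1) x :=
        (hasDerivAt_const x e).prodMk (hasDerivAt_id x)
      exact (hd.comp_hasDerivAt x hc).deriv
    rw [h1]
    exact (ih.fderiv_right (m := ∞) (by simp)).clm_apply contDiff_const

theorem iteratedDeriv_periodic {f : ℝ → ℝ} {a : ℝ} (h : Function.Periodic f a) (j : ℕ) :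
    Function.Periodic (iteratedDeriv j f) a := by
  induction j with
  | zero => simpa using h
  | succ j ih => rw [iteratedDeriv_succ]; exact deriv_add_of_periodic ih

/-- In a smooth family of periodic functions, the derivatives depend on the parameter uniformly in
the variable. -/
theorem eventually_iteratedDeriv_close {G : E → ℝ → ℝ}
    (hG : ContDiff ℝ ∞ fun q : E × ℝ => G q.1 q.2) {a : ℝ} (ha : 0 < a)
    (hper : ∀ e, Function.Periodic (G e) a) (k : ℕ) {η : ℝ} (hη : 0 < η) (e₀ : E) :
    ∀ᶠ e in 𝓝 e₀, ∀ j ≤ k, ∀ x, |iteratedDeriv j (G e₀) x - iteratedDeriv j (G e) x| < η := by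
  have key : ∀ j, ∀ᶠ e in 𝓝 e₀, ∀ x,
      |iteratedDeriv j (G e₀) x - iteratedDeriv j (G e) x| < η := by
    intro j
    have hc := (contDiff_iteratedDeriv_of_family hG j).continuous
    have h1 : ∀ᶠ e in 𝓝 e₀, ∀ x ∈ Set.Icc 0 a,
        |iteratedDeriv j (G e₀) x - iteratedDeriv j (G e) x| < η := by
      refine isCompact_Icc.eventually_forall_of_forall_eventually fun x _ => ?_
      have hc2 : Continuous fun q : E × ℝ =>
          |iteratedDeriv j (G e₀) q.2 - iteratedDeriv j (G q.1) q.2| :=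
        ((hc.comp (continuous_const.prodMk continuous_snd)).sub hc).abs
      exact (isOpen_lt hc2 continuous_const).mem_nhds (by simpa using hη)
    filter_upwards [h1] with e he x
    have hp : Function.Periodic
        (fun x => |iteratedDeriv j (G e₀) x - iteratedDeriv j (G e) x|) a := fun x => by
      simp only [iteratedDeriv_periodic (hper e₀) j x, iteratedDeriv_periodic (hper e) j x]
    obtain ⟨y, hy, hxy⟩ := hp.exists_mem_Ico₀ ha x
    rw [hxy]
    exact he y ⟨hy.1, hy.2.le⟩
  have := (Filter.eventually_all_finset (Finset.range (k + 1))).2 fun j _ => key j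
  filter_upwards [this] with e he j hj
  exact he j (Finset.mem_range.2 (by omega))

end Family

/-! ### Hermite interpolation by trigonometric polynomials -/

/-- A `π`-periodic trigonometric polynomial of mean value zero. -/
noncomputable def trigSum (a : Fin 4 → ℝ) (θ : ℝ) : ℝ :=
  a 0 * cos (2 * θ) + a 1 * sin (2 * θ) + a 2 * cos (4 * θ) + a 3 * sin (4 * θ)

/-- The derivative of `trigSum a`. -/
noncomputable def trigSumDeriv (a : Fin 4 → ℝ) (θ : ℝ) : ℝ :=
  -2 * a 0 * sin (2 * θ) + 2 * a 1 * cos (2 * θ) - 4 * a 2 * sin (4 * θ) + 4 * a 3 * cos (4 * θ)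

/-- The antiderivative of `trigSum a` of mean value zero. -/
noncomputable def trigPrimitive (a : Fin 4 → ℝ) (θ : ℝ) : ℝ :=
  a 0 * sin (2 * θ) / 2 - a 1 * cos (2 * θ) / 2 + a 2 * sin (4 * θ) / 4 - a 3 * cos (4 * θ) / 4

theorem hasDerivAt_trigSum (a : Fin 4 → ℝ) (θ : ℝ) :
    HasDerivAt (trigSum a) (trigSumDeriv a θ) θ := by
  have h2 : HasDerivAt (fun s : ℝ => 2 * s) 2 θ := by simpa using (hasDerivAt_id θ).const_mul 2
  have h4 : HasDerivAt (fun s : ℝ => 4 * s) 4 θ := by simpa using (hasDerivAt_id θ).const_mul 4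
  refine ((((h2.cos.const_mul (a 0)).add (h2.sin.const_mul (a 1))).add
    (h4.cos.const_mul (a 2))).add (h4.sin.const_mul (a 3))).congr_deriv ?_
  simp only [trigSumDeriv]; ring

theorem hasDerivAt_trigPrimitive (a : Fin 4 → ℝ) (θ : ℝ) :
    HasDerivAt (trigPrimitive a) (trigSum a θ) θ := by
  have h2 : HasDerivAt (fun s : ℝ => 2 * s) 2 θ := by simpa using (hasDerivAt_id θ).const_mul 2
  have h4 : HasDerivAt (fun s : ℝ => 4 * s) 4 θ := by simpa using (hasDerivAt_id θ).const_mul 4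
  refine (((((h2.sin.const_mul (a 0)).div_const 2).sub ((h2.cos.const_mul (a 1)).div_const 2)).add
    ((h4.sin.const_mul (a 2)).div_const 4)).sub ((h4.cos.const_mul (a 3)).div_const 4)).congr_deriv ?_
  simp only [trigSum]; ring

/-- The coefficients of the function `trigSum a` that has the values `w₁`, `w₂` and the derivatives
`w₃`, `w₄` at `θ₁ = (m - ψ) / 2` and `θ₂ = (m + ψ) / 2`. Relative to the centre of the two points the
linear system splits into an even part, of determinant `sin ψ (1 + 2 cos² ψ)`, and an odd part, of
determinant `-2 sin³ ψ`. -/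
noncomputable def interpolate (m ψ w₁ w₂ w₃ w₄ : ℝ) : Fin 4 → ℝ :=
  let A := (sin (2 * ψ) * (w₁ + w₂) - cos (2 * ψ) * (w₃ - w₄) / 4) /
    (sin ψ * (1 + 2 * cos ψ ^ 2))
  let B := (cos ψ * (w₃ - w₄) / 4 - sin ψ * (w₁ + w₂) / 2) / (sin ψ * (1 + 2 * cos ψ ^ 2))
  let C := (cos (2 * ψ) * (w₂ - w₁) - sin (2 * ψ) * (w₃ + w₄) / 4) / (-2 * sin ψ ^ 3)
  let D := (sin ψ * (w₃ + w₄) / 4 - cos ψ * (w₂ - w₁) / 2) / (-2 * sin ψ ^ 3)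
  ![A * cos m - C * sin m, A * sin m + C * cos m,
    B * cos (2 * m) - D * sin (2 * m), B * sin (2 * m) + D * cos (2 * m)]

theorem interpolate_trigSum (a : Fin 4 → ℝ) {θ₁ θ₂ : ℝ} (hs : sin (θ₂ - θ₁) ≠ 0) :
    interpolate (θ₁ + θ₂) (θ₂ - θ₁) (trigSum a θ₁) (trigSum a θ₂) (trigSumDeriv a θ₁)
      (trigSumDeriv a θ₂) = a := by
  set m := θ₁ + θ₂ with hm
  set ψ := θ₂ - θ₁ with hψ
  -- coordinates relative to the centre of the two points
  set A := a 0 * cos m + a 1 * sin m with hA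
  set C := -a 0 * sin m + a 1 * cos m with hC
  set B := a 2 * cos (2 * m) + a 3 * sin (2 * m) with hB
  set D := -a 2 * sin (2 * m) + a 3 * cos (2 * m) with hD
  have e1 : 2 * θ₁ = m - ψ := by rw [hm, hψ]; ring
  have e2 : 2 * θ₂ = m + ψ := by rw [hm, hψ]; ring
  have e3 : 4 * θ₁ = 2 * m - 2 * ψ := by rw [hm, hψ]; ring
  have e4 : 4 * θ₂ = 2 * m + 2 * ψ := by rw [hm, hψ]; ring
  have w1 : trigSum a θ₁ = A * cos ψ + B * cos (2 * ψ) - C * sin ψ - D * sin (2 * ψ) := by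
    simp only [trigSum, e1, e3, cos_sub m, sin_sub m, cos_sub (2 * m), sin_sub (2 * m), hA, hB, hC,
      hD]
    ring
  have w2 : trigSum a θ₂ = A * cos ψ + B * cos (2 * ψ) + C * sin ψ + D * sin (2 * ψ) := by
    simp only [trigSum, e2, e4, cos_add m, sin_add m, cos_add (2 * m), sin_add (2 * m), hA, hB, hC,
      hD]
    ring
  have w3 : trigSumDeriv a θ₁ = 2 * A * sin ψ + 4 * B * sin (2 * ψ) + 2 * C * cos ψ
      + 4 * D * cos (2 * ψ) := by
    simp only [trigSumDeriv, e1, e3, cos_sub m, sin_sub m, cos_sub (2 * m), sin_sub (2 * m), hA, hB,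
      hC, hD]
    ring
  have w4 : trigSumDeriv a θ₂ = -2 * A * sin ψ - 4 * B * sin (2 * ψ) + 2 * C * cos ψ
      + 4 * D * cos (2 * ψ) := by
    simp only [trigSumDeriv, e2, e4, cos_add m, sin_add m, cos_add (2 * m), sin_add (2 * m), hA, hB,
      hC, hD]
    ring
  have hsc := sin_sq_add_cos_sq ψ
  have hm1 := sin_sq_add_cos_sq m
  have hm2 := sin_sq_add_cos_sq (2 * m)
  have hd : sin ψ * (1 + 2 * cos ψ ^ 2) ≠ 0 := mul_ne_zero hs (by positivity)
  have hd' : -2 * sin ψ ^ 3 ≠ 0 := mul_ne_zero (by norm_num) (pow_ne_zero 3 hs)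
  have s2 := sin_two_mul ψ
  have c2 := cos_two_mul ψ
  have hA' : (sin (2 * ψ) * (trigSum a θ₁ + trigSum a θ₂) - cos (2 * ψ) *
      (trigSumDeriv a θ₁ - trigSumDeriv a θ₂) / 4) / (sin ψ * (1 + 2 * cos ψ ^ 2)) = A := by
    rw [div_eq_iff hd, w1, w2, w3, w4, s2, c2]; ring
  have hB' : (cos ψ * (trigSumDeriv a θ₁ - trigSumDeriv a θ₂) / 4
      - sin ψ * (trigSum a θ₁ + trigSum a θ₂) / 2) / (sin ψ * (1 + 2 * cos ψ ^ 2)) = B := by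
    rw [div_eq_iff hd, w1, w2, w3, w4, s2, c2]; ring
  have hC' : (cos (2 * ψ) * (trigSum a θ₂ - trigSum a θ₁) - sin (2 * ψ) *
      (trigSumDeriv a θ₁ + trigSumDeriv a θ₂) / 4) / (-2 * sin ψ ^ 3) = C := by
    rw [div_eq_iff hd', w1, w2, w3, w4, s2, c2]
    linear_combination (2 * C * sin ψ) * hsc
  have hD' : (sin ψ * (trigSumDeriv a θ₁ + trigSumDeriv a θ₂) / 4
      - cos ψ * (trigSum a θ₂ - trigSum a θ₁) / 2) / (-2 * sin ψ ^ 3) = D := by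
    rw [div_eq_iff hd', w1, w2, w3, w4, s2, c2]
    linear_combination (2 * D * sin ψ) * hsc
  simp only [interpolate, hA', hB', hC', hD']
  ext i
  fin_cases i
  · simp [hA, hC]; linear_combination a 0 * hm1
  · simp [hA, hC]; linear_combination a 1 * hm1
  · simp [hB, hD]; linear_combination a 2 * hm2
  · simp [hB, hD]; linear_combination a 3 * hm2

/-! ### Generic perturbations -/

/-- The pair of outer normals `θ₁`, `θ₂` belongs to a `4`-periodic orbit, expressed by the
logarithmic derivative `f` of the support function: the tangent at either point is parallel to
the position vector of the other. -/
def IsConjugatePair (f : ℝ → ℝ) (θ₁ θ₂ : ℝ) : Prop :=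
  sin (θ₂ - θ₁) ≠ 0 ∧ f θ₁ * sin (θ₂ - θ₁) = -cos (θ₂ - θ₁) ∧
    f θ₂ * sin (θ₂ - θ₁) = cos (θ₂ - θ₁)

/-- The derivative of the square of the conjugation map `θ ↦ θ + π / 2 + arctan (f θ)` at a conjugate
pair, when `f'` is the derivative of `f`. -/
noncomputable def multiplier (f' : ℝ → ℝ) (θ₁ θ₂ : ℝ) : ℝ :=
  (1 + sin (θ₂ - θ₁) ^ 2 * f' θ₁) * (1 + sin (θ₂ - θ₁) ^ 2 * f' θ₂)

/-- The perturbations of `f` that have a conjugate pair with multiplier `r`. -/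
def resonantSet (f f' : ℝ → ℝ) (r : ℝ) : Set (Fin 4 → ℝ) :=
  {a | ∃ θ₁ θ₂, IsConjugatePair (fun θ => f θ + trigSum a θ) θ₁ θ₂ ∧
    multiplier (fun θ => f' θ + trigSumDeriv a θ) θ₁ θ₂ = r}

/-- The perturbation for which `θ₁`, `θ₂` is a conjugate pair of multiplier `r` and the derivative
at `θ₁` is `τ`. -/
noncomputable def resonantCoeff (f f' : ℝ → ℝ) (r : ℝ) (x : ℝ × ℝ × ℝ) : Fin 4 → ℝ :=
  interpolate (x.1 + x.2.1) (x.2.1 - x.1)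
    (-cos (x.2.1 - x.1) / sin (x.2.1 - x.1) - f x.1)
    (cos (x.2.1 - x.1) / sin (x.2.1 - x.1) - f x.2.1)
    (x.2.2 - f' x.1)
    ((r / (1 + sin (x.2.1 - x.1) ^ 2 * x.2.2) - 1) / sin (x.2.1 - x.1) ^ 2 - f' x.2.1)

theorem contDiffAt_resonantCoeff {f f' : ℝ → ℝ} (hf : ContDiff ℝ 1 f) (hf' : ContDiff ℝ 1 f')
    (r : ℝ) {x : ℝ × ℝ × ℝ} (hs : sin (x.2.1 - x.1) ≠ 0)
    (ht : 1 + sin (x.2.1 - x.1) ^ 2 * x.2.2 ≠ 0) : ContDiffAt ℝ 1 (resonantCoeff f f' r) x := by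
  have hd : sin (x.2.1 - x.1) * (1 + 2 * cos (x.2.1 - x.1) ^ 2) ≠ 0 :=
    mul_ne_zero hs (by positivity)
  have hd' : -2 * sin (x.2.1 - x.1) ^ 3 ≠ 0 := mul_ne_zero (by norm_num) (pow_ne_zero 3 hs)
  have hs2 : sin (x.2.1 - x.1) ^ 2 ≠ 0 := pow_ne_zero 2 hs
  rw [contDiffAt_pi]
  intro i
  fin_cases i <;> simp only [resonantCoeff, interpolate] <;> simp <;>
    fun_prop (disch := first | assumption | simpa using hd | simpa using hd')

/-- Resonant perturbations are parametrized by three real numbers, the two outer normals and the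
derivative at one of them. -/
theorem resonantSet_subset (f f' : ℝ → ℝ) {r : ℝ} (hr : r ≠ 0) :
    resonantSet f f' r ⊆ resonantCoeff f f' r ''
      {x | sin (x.2.1 - x.1) ≠ 0 ∧ 1 + sin (x.2.1 - x.1) ^ 2 * x.2.2 ≠ 0} := by
  rintro a ⟨θ₁, θ₂, ⟨hs, h1, h2⟩, hmul⟩
  simp only [multiplier] at hmul
  have ht : 1 + sin (θ₂ - θ₁) ^ 2 * (f' θ₁ + trigSumDeriv a θ₁) ≠ 0 := by
    intro h0
    rw [h0, zero_mul] at hmul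
    exact hr hmul.symm
  refine ⟨(θ₁, θ₂, f' θ₁ + trigSumDeriv a θ₁), ⟨hs, ht⟩, ?_⟩
  simp only [resonantCoeff]
  have e1 : -cos (θ₂ - θ₁) / sin (θ₂ - θ₁) - f θ₁ = trigSum a θ₁ := by
    rw [← h1]; field_simp; ring
  have e2 : cos (θ₂ - θ₁) / sin (θ₂ - θ₁) - f θ₂ = trigSum a θ₂ := by
    rw [← h2]; field_simp; ring
  have e3 : f' θ₁ + trigSumDeriv a θ₁ - f' θ₁ = trigSumDeriv a θ₁ := by ring
  have e4 : (r / (1 + sin (θ₂ - θ₁) ^ 2 * (f' θ₁ + trigSumDeriv a θ₁)) - 1) / sin (θ₂ - θ₁) ^ 2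
      - f' θ₂ = trigSumDeriv a θ₂ := by
    rw [← hmul, mul_div_cancel_left₀ _ ht]; field_simp; ring
  rw [e1, e2, e3, e4, interpolate_trigSum a hs]

theorem dimH_resonantSet_le {f f' : ℝ → ℝ} (hf : ContDiff ℝ 1 f) (hf' : ContDiff ℝ 1 f')
    {r : ℝ} (hr : r ≠ 0) : dimH (resonantSet f f' r) ≤ 3 := by
  refine (dimH_mono (resonantSet_subset f f' hr)).trans ?_
  refine (dimH_image_le_of_locally_lipschitzOn fun x hx => ?_).trans ?_
  · obtain ⟨K, t, ht, hL⟩ :=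
      (contDiffAt_resonantCoeff hf hf' r hx.1 hx.2).exists_lipschitzOnWith
    exact ⟨K, t, mem_nhdsWithin_of_mem_nhds ht, hL⟩
  · refine (dimH_mono (Set.subset_univ _)).trans ?_
    rw [Real.dimH_univ_eq_finrank]
    simp

/-- Arbitrarily small perturbations have no conjugate pair of multiplier `1` or `2`. -/
theorem dense_nonresonant {f f' : ℝ → ℝ} (hf : ContDiff ℝ 1 f) (hf' : ContDiff ℝ 1 f') :
    Dense (resonantSet f f' 1 ∪ resonantSet f f' 2)ᶜ := by
  refine dense_compl_of_dimH_lt_finrank ?_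
  rw [dimH_union]
  refine (max_le (dimH_resonantSet_le hf hf' one_ne_zero)
    (dimH_resonantSet_le hf hf' two_ne_zero)).trans_lt ?_
  simp
  norm_num

/-! ### Phase space and billiard map -/

theorem pos_of_deriv_pos_of_ne_zero {f : ℝ → ℝ} (hf : Continuous f) {a b d : ℝ}
    (hd : HasDerivAt f d a) (hd0 : 0 < d) (ha : f a = 0) (hne : ∀ x ∈ Set.Ioo a b, f x ≠ 0) :
    ∀ x ∈ Set.Ioo a b, 0 < f x := by
  intro x hx
  have hsl := (hasDerivAt_iff_tendsto_slope.1 hd).eventually (lt_mem_nhds hd0)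
  have hsl' : ∀ᶠ y in 𝓝[>] a, 0 < slope f a y :=
    hsl.filter_mono (nhdsWithin_mono _ fun y hy => ne_of_gt hy)
  obtain ⟨y, hy, hyI⟩ := (hsl'.and (Ioo_mem_nhdsGT hx.1)).exists
  have hfy : 0 < f y := by
    rw [slope_def_field, ha, sub_zero] at hy
    exact (div_pos_iff_of_pos_right (sub_pos.2 hyI.1)).1 hy
  by_contra! hfx
  obtain ⟨z, hz, hz0⟩ := intermediate_value_Icc' hyI.2.le hf.continuousOn ⟨hfx, hfy.le⟩
  exact hne z ⟨hyI.1.trans_le hz.1, hz.2.trans_lt hx.2⟩ hz0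

/-- A representative of an angle in the interval of length `2π` that starts at a given number. -/
theorem exists_rep_after (t : Real.Angle) {a : ℝ} (h : (a : Real.Angle) ≠ t) :
    ∃ s : ℝ, (s : Real.Angle) = t ∧ a < s ∧ s < a + 2 * π := by
  obtain ⟨s, hs, h1, h2⟩ := exists_rep_near t.toReal (a + π)
  rw [Real.Angle.coe_toReal] at hs
  refine ⟨s, hs, by linarith, lt_of_le_of_ne (by linarith) ?_⟩
  rintro rfl
  apply h
  rw [← hs]
  simp

theorem eq_of_coe_eq_of_mem {a s s' : ℝ} (h : (s : Real.Angle) = s') (h1 : a < s)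
    (h2 : s < a + 2 * π) (h1' : a < s') (h2' : s' < a + 2 * π) : s = s' := by
  obtain ⟨k, hk⟩ := Real.Angle.angle_eq_iff_two_pi_dvd_sub.1 h
  have hpi := pi_pos
  have hk1 : (k : ℝ) < 1 := by
    by_contra! hc
    nlinarith
  have hk2 : (-1 : ℝ) < k := by
    by_contra! hc
    nlinarith
  have h3 : k < 1 := by exact_mod_cast hk1
  have h4 : -1 < k := by exact_mod_cast hk2
  have h5 : k = 0 := by omega
  rw [h5] at hk
  simp at hk
  linarith

theorem coe_eq_or_of_sin_eq_zero {θ θ' : ℝ} (h : sin (θ' - θ) = 0) :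
    (θ' : Real.Angle) = θ ∨ (θ' : Real.Angle) = (θ + π : ℝ) := by
  have hsc := sin_sq_add_cos_sq (θ' - θ)
  rw [h] at hsc
  have hc : (cos (θ' - θ) - 1) * (cos (θ' - θ) + 1) = 0 := by linear_combination hsc
  rcases mul_eq_zero.1 hc with h1 | h1
  · left
    have := Real.Angle.cos_sin_inj (θ := θ' - θ) (ψ := 0) (by rw [cos_zero]; linarith)
      (by rw [h, sin_zero])
    rwa [Real.Angle.coe_sub, Real.Angle.coe_zero, sub_eq_zero] at this
  · right
    have := Real.Angle.cos_sin_inj (θ := θ' - θ) (ψ := π) (by rw [cos_pi]; linarith)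
      (by rw [h, sin_pi])
    rw [Real.Angle.coe_sub, sub_eq_iff_eq_add] at this
    rw [this, Real.Angle.coe_add, add_comm]

section Billiard

variable {n : WithTop ℕ∞} {γ : Real.Angle → Plane} {Ω : Set Plane} {c : Plane}

theorem IsBoundaryParam.det_velocity (h : IsBoundaryParam n γ Ω) (hn : 2 ≤ n) {T T' θ θ' : ℝ}
    (hT : SupportsAt γ T θ) (hT' : SupportsAt γ T' θ') :
    det (velocity γ (T : Real.Angle)) (velocity γ (T' : Real.Angle)) =
      tangentComp (velocity γ (T : Real.Angle)) θ * tangentComp (velocity γ (T' : Real.Angle)) θ' *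
        sin (θ' - θ) := by
  rw [det_eq_neg_of_normalComp_eq_zero (h.normalComp_velocity_eq_zero hn hT),
    normalComp_rotate _ θ' θ, h.normalComp_velocity_eq_zero hn hT', ← neg_sub θ' θ, sin_neg]
  ring

theorem IsBoundaryParam.det_velocity_pos_iff (h : IsBoundaryParam n γ Ω) (hn : 2 ≤ n)
    {T T' θ θ' : ℝ} (hT : SupportsAt γ T θ) (hT' : SupportsAt γ T' θ') :
    0 < det (velocity γ (T : Real.Angle)) (velocity γ (T' : Real.Angle)) ↔ 0 < sin (θ' - θ) := by
  rw [h.det_velocity hn hT hT']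
  exact mul_pos_iff_of_pos_left (mul_pos (h.comp_velocity hn hT).1 (h.comp_velocity hn hT').1)

/-- The phase space consists of the pairs of points whose velocities are positively oriented. -/
theorem IsBoundaryParam.mem_phaseSpace_iff (h : IsBoundaryParam n γ Ω) (hn : 2 ≤ n)
    (ho : IsOpen Ω) (hb : Bornology.IsBounded Ω) (hconv : Convex ℝ Ω) (t₁ t₂ : Real.Angle) :
    (t₁, t₂) ∈ phaseSpace γ ↔ 0 < det (velocity γ t₁) (velocity γ t₂) := by
  -- the determinant has exactly one zero `S` between `T` and `T + 2π`, and changes its sign there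
  have main : ∀ T : ℝ, ∃ S, T < S ∧ S < T + 2 * π ∧
      det (velocity γ (T : Real.Angle)) (velocity γ (S : Real.Angle)) = 0 ∧
      (∀ R, T < R → R < T + 2 * π →
        det (velocity γ (T : Real.Angle)) (velocity γ (R : Real.Angle)) = 0 → R = S) ∧
      (∀ R ∈ Set.Ioo T S, 0 < det (velocity γ (T : Real.Angle)) (velocity γ (R : Real.Angle))) ∧
      (∀ R ∈ Set.Ioo S (T + 2 * π),
        det (velocity γ (T : Real.Angle)) (velocity γ (R : Real.Angle)) < 0) := by
    intro T
    obtain ⟨θ, hT⟩ := h.exists_normal ho hconv T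
    obtain ⟨S₀, hS₀⟩ := h.exists_supportsAt (θ + π)
    have hTS : (T : Real.Angle) ≠ S₀ := by
      intro heq
      have h1 := h.normal_unique hn hT (hS₀.congr_left heq.symm)
      have h2 : ((π : ℝ) : Real.Angle) = 0 := by
        rw [Real.Angle.coe_add] at h1
        exact left_eq_add.1 h1
      exact Real.Angle.pi_ne_zero h2
    obtain ⟨S, hS, hS1, hS2⟩ := exists_rep_after _ hTS
    have hsupS : SupportsAt γ S (θ + π) := hS₀.congr_left hS.symm
    have hG : ∀ R : ℝ, det (velocity γ (T : Real.Angle)) (velocity γ (R : Real.Angle))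
        = -(tangentComp (velocity γ (T : Real.Angle)) θ *
          normalComp (velocity γ (R : Real.Angle)) θ) := fun R =>
      det_eq_neg_of_normalComp_eq_zero (h.normalComp_velocity_eq_zero hn hT) _
    have hGd : ∀ R : ℝ, HasDerivAt
        (fun R : ℝ => det (velocity γ (T : Real.Angle)) (velocity γ (R : Real.Angle)))
        (-(tangentComp (velocity γ (T : Real.Angle)) θ *
          normalComp (velocity (velocity γ) (R : Real.Angle)) θ)) R := by
      intro R
      simp only [hG]
      have := hasDerivAt_normalComp_comp (h.hasDerivAt_velocity hn R) (hasDerivAt_const R θ)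
      refine ((this.const_mul _).neg).congr_deriv ?_
      ring
    have hGc : Continuous
        (fun R : ℝ => det (velocity γ (T : Real.Angle)) (velocity γ (R : Real.Angle))) :=
      continuous_iff_continuousAt.2 fun R => (hGd R).continuousAt
    have hSzero : det (velocity γ (T : Real.Angle)) (velocity γ (S : Real.Angle)) = 0 := by
      rw [h.det_velocity hn hT hsupS]; simp
    have hTzero : det (velocity γ (T : Real.Angle)) (velocity γ (T : Real.Angle)) = 0 := by
      rw [h.det_velocity hn hT hT]; simp
    obtain ⟨hμ, hν⟩ := h.comp_velocity hn hT
    have huniq : ∀ R, T < R → R < T + 2 * π →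
        det (velocity γ (T : Real.Angle)) (velocity γ (R : Real.Angle)) = 0 → R = S := by
      intro R hR1 hR2 hR0
      obtain ⟨θR, hθR⟩ := h.exists_normal ho hconv R
      rw [h.det_velocity hn hT hθR] at hR0
      have hsin : sin (θR - θ) = 0 :=
        (mul_eq_zero.1 hR0).resolve_left (mul_pos hμ (h.comp_velocity hn hθR).1).ne'
      rcases coe_eq_or_of_sin_eq_zero hsin with h1 | h1
      · exfalso
        have h2 := h.param_unique hn ho hb hconv (hθR.congr h1) hT
        have h4 := eq_of_coe_eq_of_mem (a := (R + T) / 2 - π) h2 (by linarith) (by linarith)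
          (by linarith) (by linarith)
        linarith
      · exact eq_of_coe_eq_of_mem (h.param_unique hn ho hb hconv (hθR.congr h1) hsupS)
          hR1 hR2 hS1 hS2
    refine ⟨S, hS1, hS2, hSzero, huniq, ?_, ?_⟩
    · refine pos_of_deriv_pos_of_ne_zero hGc (hGd T) ?_ hTzero fun R hR h0 => ?_
      · have := mul_neg_of_pos_of_neg hμ hν
        linarith
      · exact hR.2.ne (huniq R hR.1 (hR.2.trans hS2) h0)
    · have hνS := (h.comp_velocity hn hsupS).2
      rw [normalComp_add_pi] at hνS
      have hpos := pos_of_deriv_pos_of_ne_zero (b := T + 2 * π) hGc.neg (hGd S).neg ?_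
        (by simpa using hSzero) fun R hR h0 => ?_
      · intro R hR
        simpa using hpos R hR
      · rw [neg_neg]
        exact mul_pos hμ (by linarith)
      · exact hR.1.ne' (huniq R (hS1.trans hR.1) hR.2 (neg_eq_zero.1 h0))
  constructor
  · rintro ⟨T₁, T₁', T₂, h1, h2, h3, h4, h5, h6, h7⟩
    simp only at h1 h2
    obtain ⟨S, -, -, -, huniq, hpos, -⟩ := main T₁
    rw [← h1, ← h2]
    exact hpos T₂ ⟨h6, huniq T₁' h3 h4 h5 ▸ h7⟩
  · intro hdet
    obtain ⟨S, hS1, hS2, hS0, -, -, hneg⟩ := main t₁.toReal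
    have hne : (t₁.toReal : Real.Angle) ≠ t₂ := by
      rw [Real.Angle.coe_toReal]
      rintro rfl
      simp [det, mul_comm] at hdet
    obtain ⟨T₂, hT₂, h1, h2⟩ := exists_rep_after _ hne
    refine ⟨t₁.toReal, S, T₂, Real.Angle.coe_toReal _, hT₂, hS1, hS2, hS0, h1, ?_⟩
    rw [← hT₂, ← Real.Angle.coe_toReal t₁] at hdet
    by_contra! hle
    rcases hle.eq_or_lt with rfl | hlt
    · rw [hS0] at hdet
      exact lt_irrefl _ hdet
    · exact absurd hdet (not_lt.2 (hneg T₂ ⟨hlt, h2⟩).le)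

/-- The parametrization by the angle of the outer normal. -/
theorem IsBoundaryParam.eq_envelope (h : IsBoundaryParam n γ Ω) (hn : 2 ≤ n)
    (ho : IsOpen Ω) (hb : Bornology.IsBounded Ω) (hconv : Convex ℝ Ω) (c : Plane) {T θ : ℝ}
    (hT : SupportsAt γ T θ) : γ (T : Real.Angle) = envelope c (supportFunction c Ω) θ :=
  eq_envelope_of_comp (h.supportFunction_eq ho hb c hT).symm
    (h.hasDerivAt_supportFunction hn ho hb hconv c hT).deriv.symm

theorem IsBoundaryParam.contDiff_two_supportFunction (h : IsBoundaryParam n γ Ω) (hn : 2 ≤ n)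
    (ho : IsOpen Ω) (hb : Bornology.IsBounded Ω) (hconv : Convex ℝ Ω) (c : Plane) :
    ContDiff ℝ 2 (supportFunction c Ω) := by
  have h2 : IsBoundaryParam (2 : ℕ) γ Ω :=
    ⟨h.contDiff.of_le (by exact_mod_cast hn), h.injective, h.range_eq, h.regular, h.curvature_pos⟩
  exact_mod_cast h2.contDiff_supportFunction le_rfl ho hb hconv c

/-- For each point of the phase space, exactly one bounce follows. The
collision law prescribes the height of the third point in the direction of the second outer normal,
and this height is strictly monotone on the admissible half of the curve. -/
theorem IsBoundaryParam.existsUnique_next (h : IsBoundaryParam n γ Ω) (hn : 2 ≤ n)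
    (ho : IsOpen Ω) (hb : Bornology.IsBounded Ω) (hconv : Convex ℝ Ω)
    (hc : IsCentrallySymmetric Ω c) {t₁ t₂ : Real.Angle}
    (h12 : 0 < det (velocity γ t₁) (velocity γ t₂)) :
    ∃! t₃, 0 < det (velocity γ t₂) (velocity γ t₃) ∧ det (velocity γ t₂) (γ t₃ - γ t₁) = 0 := by
  set P := supportFunction c Ω with hP
  have hP2 : ContDiff ℝ 2 P := h.contDiff_two_supportFunction hn ho hb hconv c
  have hPπ : ∀ θ, P (θ + π) = P θ := h.supportFunction_add_pi ho hb hc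
  have hPρ := h.supportFunction_curvature_pos hn ho hb hconv c
  have hper := two_pi_periodic hPπ
  obtain ⟨T₁, rfl⟩ : ∃ T : ℝ, (T : Real.Angle) = t₁ := ⟨_, Real.Angle.coe_toReal t₁⟩
  obtain ⟨T₂, rfl⟩ : ∃ T : ℝ, (T : Real.Angle) = t₂ := ⟨_, Real.Angle.coe_toReal t₂⟩
  obtain ⟨θ₁, hθ₁⟩ := h.exists_normal ho hconv T₁
  obtain ⟨θ₂, hθ₂⟩ := h.exists_normal ho hconv T₂
  rw [h.det_velocity_pos_iff hn hθ₁ hθ₂] at h12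
  have hμ₂ := (h.comp_velocity hn hθ₂).1
  -- the collision law in terms of the heights
  have hlaw : ∀ {T₃ θ₃ : ℝ}, SupportsAt γ T₃ θ₃ →
      (det (velocity γ (T₂ : Real.Angle)) (γ (T₃ : Real.Angle) - γ (T₁ : Real.Angle)) = 0 ↔
        normalComp (envelope c P θ₃ - c) θ₂ = normalComp (envelope c P θ₁ - c) θ₂) := by
    intro T₃ θ₃ hθ₃
    rw [det_eq_neg_of_normalComp_eq_zero (h.normalComp_velocity_eq_zero hn hθ₂),
      h.eq_envelope hn ho hb hconv c hθ₁, h.eq_envelope hn ho hb hconv c hθ₃, neg_eq_zero,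
      mul_eq_zero, or_iff_right hμ₂.ne', normalComp_sub, normalComp_sub, normalComp_sub, sub_eq_zero,
      sub_left_inj]
  have hanti := strictAntiOn_normalComp_envelope c hP2 hPρ θ₂
  have hpi := pi_pos
  -- existence
  have hne1 : (θ₁ : Real.Angle) ≠ θ₂ := by
    intro heq
    obtain ⟨k, hk⟩ := Real.Angle.angle_eq_iff_two_pi_dvd_sub.1 heq.symm
    have : θ₂ - θ₁ = (2 * k : ℤ) * π := by push_cast; linarith
    rw [this, sin_int_mul_pi] at h12
    exact lt_irrefl _ h12
  have hne2 : (θ₁ : Real.Angle) ≠ (θ₂ + π : ℝ) := by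
    intro heq
    obtain ⟨k, hk⟩ := Real.Angle.angle_eq_iff_two_pi_dvd_sub.1 heq.symm
    have : θ₂ - θ₁ = (2 * k - 1 : ℤ) * π := by push_cast; linarith
    rw [this, sin_int_mul_pi] at h12
    exact lt_irrefl _ h12
  have hlt1 := normalComp_envelope_lt c hP2 hper hPρ hne1
  have hlt2 := normalComp_envelope_lt c hP2 hper hPρ hne2
  rw [normalComp_add_pi, hPπ] at hlt2
  have hcont : ContinuousOn (fun s => normalComp (envelope c P s - c) θ₂)
      (Set.Icc θ₂ (θ₂ + π)) := fun s _ =>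
    (hasDerivAt_normalComp_envelope c hP2 θ₂ s).continuousAt.continuousWithinAt
  have hend : normalComp (envelope c P (θ₂ + π) - c) θ₂ = -P θ₂ := by
    rw [normalComp_envelope, hPπ]; simp
  obtain ⟨θ₃, hθ₃I, hθ₃⟩ := intermediate_value_Ioo' (by linarith : θ₂ ≤ θ₂ + π) hcont
    (show normalComp (envelope c P θ₁ - c) θ₂ ∈ Set.Ioo _ _ from
      ⟨by rw [hend]; linarith, by rw [normalComp_envelope_self]; exact hlt1⟩)
  obtain ⟨T₃, hT₃⟩ := h.exists_supportsAt θ₃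
  refine ⟨(T₃ : Real.Angle), ⟨?_, (hlaw hT₃).2 hθ₃⟩, ?_⟩
  · rw [h.det_velocity_pos_iff hn hθ₂ hT₃]
    exact sin_pos_of_pos_of_lt_pi (by linarith [hθ₃I.1]) (by linarith [hθ₃I.2])
  · -- uniqueness
    rintro t ⟨ht1, ht2⟩
    obtain ⟨T, rfl⟩ : ∃ T : ℝ, (T : Real.Angle) = t := ⟨_, Real.Angle.coe_toReal t⟩
    obtain ⟨θ', hθ'⟩ := h.exists_normal ho hconv T
    obtain ⟨θ, hθ, hb1, hb2⟩ := exists_rep_near θ' θ₂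
    have hsup : SupportsAt γ T θ := hθ'.congr hθ.symm
    rw [h.det_velocity_pos_iff hn hθ₂ hsup] at ht1
    have hpos : θ₂ < θ := by
      by_contra! hle
      have := sin_nonpos_of_nonpos_of_neg_pi_le (x := θ - θ₂) (by linarith) (by linarith)
      linarith
    have heq := hanti.injOn ⟨hpos.le, hb2⟩ ⟨hθ₃I.1.le, hθ₃I.2.le⟩
      (((hlaw hsup).1 ht2).trans hθ₃.symm)
    exact h.param_unique hn ho hb hconv (heq ▸ hsup) hT₃

theorem IsBoundaryParam.nextBounce_spec (h : IsBoundaryParam n γ Ω) (hn : 2 ≤ n)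
    (ho : IsOpen Ω) (hb : Bornology.IsBounded Ω) (hconv : Convex ℝ Ω)
    (hc : IsCentrallySymmetric Ω c) {t₁ t₂ : Real.Angle}
    (h12 : 0 < det (velocity γ t₁) (velocity γ t₂)) :
    0 < det (velocity γ t₂) (velocity γ (nextBounce γ t₁ t₂)) ∧
      det (velocity γ t₂) (γ (nextBounce γ t₁ t₂) - γ t₁) = 0 := by
  obtain ⟨t₃, h3, -⟩ := h.existsUnique_next hn ho hb hconv hc h12
  have := Classical.epsilon_spec (p := fun t₃ =>
    (t₂, t₃) ∈ phaseSpace γ ∧ det (velocity γ t₂) (γ t₃ - γ t₁) = 0)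
    ⟨t₃, (h.mem_phaseSpace_iff hn ho hb hconv _ _).2 h3.1, h3.2⟩
  exact ⟨(h.mem_phaseSpace_iff hn ho hb hconv _ _).1 this.1, this.2⟩

theorem IsBoundaryParam.nextBounce_eq (h : IsBoundaryParam n γ Ω) (hn : 2 ≤ n)
    (ho : IsOpen Ω) (hb : Bornology.IsBounded Ω) (hconv : Convex ℝ Ω)
    (hc : IsCentrallySymmetric Ω c) {t₁ t₂ t₃ : Real.Angle}
    (h12 : 0 < det (velocity γ t₁) (velocity γ t₂))
    (h23 : 0 < det (velocity γ t₂) (velocity γ t₃))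
    (hlaw : det (velocity γ t₂) (γ t₃ - γ t₁) = 0) : nextBounce γ t₁ t₂ = t₃ :=
  (h.existsUnique_next hn ho hb hconv hc h12).unique
    (h.nextBounce_spec hn ho hb hconv hc h12) ⟨h23, hlaw⟩

end Billiard

/-! ### Four-periodic orbits -/

theorem sin_eq_zero_of_normalComp_eq_zero {w : Plane} (hw : w ≠ 0) {θ θ' : ℝ}
    (h : normalComp w θ = 0) (h' : normalComp w θ' = 0) : sin (θ' - θ) = 0 := by
  rw [normalComp_rotate w θ, h, zero_mul, zero_add] at h'
  refine (mul_eq_zero.1 h').resolve_left fun h0 => hw ?_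
  exact eq_of_comp_eq (θ := θ) (by rw [h]; simp [normalComp]) (by rw [h0]; simp [tangentComp])

theorem det_swap (v w : Plane) : det v w = -det w v := by
  simp only [det]; ring

section FourPeriodic

variable {n : WithTop ℕ∞} {γ : Real.Angle → Plane} {Ω : Set Plane} {c : Plane}

theorem IsBoundaryParam.antipode (h : IsBoundaryParam n γ Ω) (hn : 2 ≤ n)
    (ho : IsOpen Ω) (hb : Bornology.IsBounded Ω) (hconv : Convex ℝ Ω)
    (hc : IsCentrallySymmetric Ω c) {T T' θ : ℝ} (hT : SupportsAt γ T θ)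
    (hT' : SupportsAt γ T' (θ + π)) :
    γ (T' : Real.Angle) - c = -(γ (T : Real.Angle) - c) := by
  rw [h.eq_envelope hn ho hb hconv c hT, h.eq_envelope hn ho hb hconv c hT',
    envelope_add_pi_sub c (h.supportFunction_add_pi ho hb hc)]

/-- The points of a `4`-periodic orbit are `t₁`, `t₂` and their antipodes, and the position vector of
each of `t₁`, `t₂` is parallel to the tangent at the other: the chord between the first and the third
point is parallel to the tangents at the second and the fourth, so these two are parallel to
each other, and likewise for the first and the third tangent. -/
theorem IsBoundaryParam.fourPeriodic_normals (h : IsBoundaryParam n γ Ω) (hn : 2 ≤ n)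
    (ho : IsOpen Ω) (hb : Bornology.IsBounded Ω) (hconv : Convex ℝ Ω)
    (hc : IsCentrallySymmetric Ω c) {x : Real.Angle × Real.Angle}
    (hx : x ∈ fourPeriodicPoints γ) :
    ∃ T₁ T₂ θ₁ θ₂ : ℝ, x = ((T₁ : Real.Angle), (T₂ : Real.Angle)) ∧ SupportsAt γ T₁ θ₁ ∧
      SupportsAt γ T₂ θ₂ ∧ 0 < sin (θ₂ - θ₁) ∧ normalComp (γ (T₁ : Real.Angle) - c) θ₂ = 0 ∧
      normalComp (γ (T₂ : Real.Angle) - c) θ₁ = 0 := by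
  obtain ⟨t₁, t₂⟩ := x
  obtain ⟨hphase, hper⟩ := hx
  set t₃ := nextBounce γ t₁ t₂ with ht₃
  set t₄ := nextBounce γ t₂ t₃ with ht₄
  have hper' : (nextBounce γ t₃ t₄, nextBounce γ t₄ (nextBounce γ t₃ t₄)) = (t₁, t₂) := hper
  have ht₁ : nextBounce γ t₃ t₄ = t₁ := congrArg Prod.fst hper'
  have ht₂ : nextBounce γ t₄ t₁ = t₂ := by
    have := congrArg Prod.snd hper'
    simp only [ht₁] at this
    exact this
  have d12 := (h.mem_phaseSpace_iff hn ho hb hconv _ _).1 hphase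
  obtain ⟨d23, l2⟩ := h.nextBounce_spec hn ho hb hconv hc d12
  rw [← ht₃] at d23 l2
  obtain ⟨d34, l3⟩ := h.nextBounce_spec hn ho hb hconv hc d23
  rw [← ht₄] at d34 l3
  obtain ⟨d41, l4⟩ := h.nextBounce_spec hn ho hb hconv hc d34
  rw [ht₁] at d41 l4
  obtain ⟨-, l1⟩ := h.nextBounce_spec hn ho hb hconv hc d41
  rw [ht₂] at l1
  clear_value t₃ t₄
  clear ht₁ ht₂ ht₃ ht₄ hper hper' hphase
  obtain ⟨T₁, rfl⟩ : ∃ T : ℝ, (T : Real.Angle) = t₁ := ⟨_, Real.Angle.coe_toReal t₁⟩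
  obtain ⟨T₂, rfl⟩ : ∃ T : ℝ, (T : Real.Angle) = t₂ := ⟨_, Real.Angle.coe_toReal t₂⟩
  obtain ⟨T₃, rfl⟩ : ∃ T : ℝ, (T : Real.Angle) = t₃ := ⟨_, Real.Angle.coe_toReal t₃⟩
  obtain ⟨T₄, rfl⟩ : ∃ T : ℝ, (T : Real.Angle) = t₄ := ⟨_, Real.Angle.coe_toReal t₄⟩
  obtain ⟨θ₁, hθ₁⟩ := h.exists_normal ho hconv T₁
  obtain ⟨θ₂, hθ₂⟩ := h.exists_normal ho hconv T₂
  obtain ⟨θ₃, hθ₃⟩ := h.exists_normal ho hconv T₃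
  obtain ⟨θ₄, hθ₄⟩ := h.exists_normal ho hconv T₄
  have law : ∀ {T θ : ℝ}, SupportsAt γ T θ → ∀ w, det (velocity γ (T : Real.Angle)) w = 0 →
      normalComp w θ = 0 := by
    intro T θ hT w hw
    rw [det_eq_neg_of_normalComp_eq_zero (h.normalComp_velocity_eq_zero hn hT), neg_eq_zero] at hw
    exact (mul_eq_zero.1 hw).resolve_left (h.comp_velocity hn hT).1.ne'
  have m2 := law hθ₂ _ l2
  have m3 := law hθ₃ _ l3
  have m4 := law hθ₄ _ l4
  have m1 := law hθ₁ _ l1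
  have n31 : γ (T₃ : Real.Angle) - γ (T₁ : Real.Angle) ≠ 0 := by
    intro h0
    rw [h.injective (sub_eq_zero.1 h0), det_swap] at d23
    linarith
  have n42 : γ (T₄ : Real.Angle) - γ (T₂ : Real.Angle) ≠ 0 := by
    intro h0
    rw [h.injective (sub_eq_zero.1 h0), det_swap] at d34
    linarith
  have m4' : normalComp (γ (T₃ : Real.Angle) - γ (T₁ : Real.Angle)) θ₄ = 0 := by
    rw [← neg_sub, normalComp_neg, m4, neg_zero]
  have m1' : normalComp (γ (T₄ : Real.Angle) - γ (T₂ : Real.Angle)) θ₁ = 0 := by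
    rw [← neg_sub, normalComp_neg, m1, neg_zero]
  have a4 : SupportsAt γ T₄ (θ₂ + π) := by
    rcases coe_eq_or_of_sin_eq_zero (sin_eq_zero_of_normalComp_eq_zero n31 m2 m4') with h1 | h1
    · exact absurd (by rw [h.param_unique hn ho hb hconv (hθ₄.congr h1) hθ₂, sub_self]) n42
    · exact hθ₄.congr h1
  have a3 : SupportsAt γ T₃ (θ₁ + π) := by
    rcases coe_eq_or_of_sin_eq_zero (sin_eq_zero_of_normalComp_eq_zero n42 m1' m3) with h1 | h1
    · exact absurd (by rw [h.param_unique hn ho hb hconv (hθ₃.congr h1) hθ₁, sub_self]) n31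
    · exact hθ₃.congr h1
  refine ⟨T₁, T₂, θ₁, θ₂, rfl, hθ₁, hθ₂, (h.det_velocity_pos_iff hn hθ₁ hθ₂).1 d12, ?_, ?_⟩
  · have := h.antipode hn ho hb hconv hc hθ₁ a3
    rw [← sub_sub_sub_cancel_right _ _ c, normalComp_sub, this, normalComp_neg] at m2
    linarith
  · have := h.antipode hn ho hb hconv hc hθ₂ a4
    rw [← sub_sub_sub_cancel_right _ _ c, normalComp_sub, this, normalComp_neg] at m1'
    linarith

theorem isConjugatePair_of_normalComp {P : ℝ → ℝ} (hpos : ∀ θ, 0 < P θ) {θ₁ θ₂ : ℝ}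
    (hs : 0 < sin (θ₂ - θ₁)) (h1 : normalComp (envelope c P θ₁ - c) θ₂ = 0)
    (h2 : normalComp (envelope c P θ₂ - c) θ₁ = 0) :
    IsConjugatePair (fun θ => deriv P θ / P θ) θ₁ θ₂ := by
  rw [normalComp_envelope, ← neg_sub θ₂ θ₁, cos_neg, sin_neg] at h1
  rw [normalComp_envelope] at h2
  refine ⟨hs.ne', ?_, ?_⟩
  · have := (hpos θ₁).ne'
    field_simp
    linarith
  · have := (hpos θ₂).ne'
    field_simp
    linarith

/-- A conjugate pair is determined by its first normal through the conjugation map. -/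
theorem IsConjugatePair.coe_eq {f : ℝ → ℝ} {θ₁ θ₂ : ℝ} (h : IsConjugatePair f θ₁ θ₂)
    (hs : 0 < sin (θ₂ - θ₁)) : (θ₂ : Real.Angle) = (θ₁ + π / 2 + arctan (f θ₁) : ℝ) := by
  have hsc := sin_sq_add_cos_sq (θ₂ - θ₁)
  have h1 := h.2.1
  have hs1 : sin (θ₂ - θ₁) ^ 2 * (1 + f θ₁ ^ 2) = 1 := by
    linear_combination (f θ₁ * sin (θ₂ - θ₁) - cos (θ₂ - θ₁)) * h1 + hsc
  have hsq : 0 < √(1 + f θ₁ ^ 2) := by positivity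
  have hs2 : sin (θ₂ - θ₁) = cos (arctan (f θ₁)) := by
    rw [cos_arctan, eq_div_iff hsq.ne']
    have : (sin (θ₂ - θ₁) * √(1 + f θ₁ ^ 2)) ^ 2 = 1 := by
      rw [mul_pow, sq_sqrt (by positivity), hs1]
    have h3 : 0 < sin (θ₂ - θ₁) * √(1 + f θ₁ ^ 2) := mul_pos hs hsq
    nlinarith
  have hc2 : cos (θ₂ - θ₁) = -sin (arctan (f θ₁)) := by
    have hne : cos (arctan (f θ₁)) ≠ 0 := (cos_arctan_pos _).ne'
    rw [← tan_mul_cos hne, tan_arctan, ← hs2]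
    linarith
  have := Real.Angle.cos_sin_inj (θ := θ₂ - θ₁) (ψ := arctan (f θ₁) + π / 2)
    (by rw [hc2, cos_add_pi_div_two]) (by rw [hs2, sin_add_pi_div_two])
  rw [Real.Angle.coe_sub, sub_eq_iff_eq_add] at this
  rw [this, ← Real.Angle.coe_add]
  congr 1
  ring

/-- If no conjugate pair has multiplier `1`, then there are only finitely many of them up to
periodicity: their first normals are simple zeros of a function of one variable. -/
theorem finite_conjugate_zeros {f f' : ℝ → ℝ} (hf : ∀ θ, HasDerivAt f (f' θ) θ)
    (hmult : ∀ θ₁ θ₂, IsConjugatePair f θ₁ θ₂ → multiplier f' θ₁ θ₂ ≠ 1) :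
    {θ ∈ Set.Icc (-π) π | f θ + f (θ + π / 2 + arctan (f θ)) = 0}.Finite := by
  refine finite_zeros_of_deriv_ne_zero isCompact_Icc
    (f' := fun θ => f' θ + f' (θ + π / 2 + arctan (f θ)) * (1 + 1 / (1 + f θ ^ 2) * f' θ))
    (fun θ => ?_) fun θ h0 hd => ?_
  · have h1 : HasDerivAt (fun θ => θ + π / 2 + arctan (f θ)) (1 + 1 / (1 + f θ ^ 2) * f' θ) θ :=
      ((hasDerivAt_id θ).add_const _).add (hf θ).arctan
    exact (hf θ).add ((hf _).comp θ h1)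
  · set θ' := θ + π / 2 + arctan (f θ) with hθ'
    have e : θ' - θ = arctan (f θ) + π / 2 := by rw [hθ']; ring
    have hs : sin (θ' - θ) = cos (arctan (f θ)) := by rw [e, sin_add_pi_div_two]
    have hc : cos (θ' - θ) = -sin (arctan (f θ)) := by rw [e, cos_add_pi_div_two]
    have hcos := cos_arctan_pos (f θ)
    have hsin : sin (arctan (f θ)) = f θ * cos (arctan (f θ)) := by
      rw [← tan_mul_cos hcos.ne', tan_arctan]
    refine hmult θ θ' ⟨?_, ?_, ?_⟩ ?_
    · rw [hs]; exact hcos.ne'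
    · rw [hs, hc, hsin]; ring
    · rw [hs, hc, hsin]; linear_combination cos (arctan (f θ)) * h0
    · simp only [multiplier, hs]
      have hsq : cos (arctan (f θ)) ^ 2 = 1 / (1 + f θ ^ 2) := cos_sq_arctan _
      rw [hsq]
      linear_combination 1 / (1 + f θ ^ 2) * hd

theorem IsBoundaryParam.finite_fourPeriodicPoints (h : IsBoundaryParam n γ Ω) (hn : 2 ≤ n)
    (ho : IsOpen Ω) (hb : Bornology.IsBounded Ω) (hconv : Convex ℝ Ω)
    (hc : IsCentrallySymmetric Ω c) {f' : ℝ → ℝ}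
    (hf : ∀ θ, HasDerivAt (fun θ => deriv (supportFunction c Ω) θ / supportFunction c Ω θ)
      (f' θ) θ)
    (hmult : ∀ θ₁ θ₂, IsConjugatePair
      (fun θ => deriv (supportFunction c Ω) θ / supportFunction c Ω θ) θ₁ θ₂ →
      multiplier f' θ₁ θ₂ ≠ 1) :
    (fourPeriodicPoints γ).Finite := by
  set P := supportFunction c Ω with hP
  set f : ℝ → ℝ := fun θ => deriv P θ / P θ with hfdef
  have hPπ : ∀ θ, P (θ + π) = P θ := h.supportFunction_add_pi ho hb hc
  have hfper : Function.Periodic f (2 * π) := fun θ => by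
    simp only [hfdef, two_pi_periodic hPπ, deriv_add_of_periodic (two_pi_periodic hPπ)]
  have hfcongr : ∀ {θ θ' : ℝ}, (θ : Real.Angle) = θ' → f θ = f θ' := by
    intro θ θ' hθ
    obtain ⟨k, hk⟩ := Real.Angle.angle_eq_iff_two_pi_dvd_sub.1 hθ
    rw [show θ = θ' + k * (2 * π) by linarith]
    exact hfper.int_mul k θ'
  choose τ hτ using h.exists_supportsAt
  refine ((finite_conjugate_zeros hf hmult).image fun θ =>
    (((τ θ : ℝ) : Real.Angle), ((τ (θ + π / 2 + arctan (f θ)) : ℝ) : Real.Angle))).subset ?_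
  intro x hx
  obtain ⟨T₁, T₂, θ₁, θ₂, rfl, hθ₁, hθ₂, hs, m1, m2⟩ :=
    h.fourPeriodic_normals hn ho hb hconv hc hx
  rw [h.eq_envelope hn ho hb hconv c hθ₁] at m1
  rw [h.eq_envelope hn ho hb hconv c hθ₂] at m2
  have hpair : IsConjugatePair f θ₁ θ₂ :=
    isConjugatePair_of_normalComp (h.supportFunction_pos ho hb hc) hs m1 m2
  have hθ₂' := hpair.coe_eq hs
  set θ := (θ₁ : Real.Angle).toReal with hθ
  have hθc : (θ : Real.Angle) = θ₁ := Real.Angle.coe_toReal _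
  have hfθ : f θ = f θ₁ := hfcongr hθc
  have hθ₂'' : (θ₂ : Real.Angle) = (θ + π / 2 + arctan (f θ) : ℝ) := by
    rw [hθ₂', hfθ, add_assoc, add_assoc, Real.Angle.coe_add, ← hθc, ← Real.Angle.coe_add]
  refine ⟨θ, ⟨⟨(Real.Angle.neg_pi_lt_toReal _).le, Real.Angle.toReal_le_pi _⟩, ?_⟩, ?_⟩
  · rw [← hfcongr hθ₂'', hfθ]
    have h1 := hpair.2.1
    have h2 := hpair.2.2
    have : (f θ₁ + f θ₂) * sin (θ₂ - θ₁) = 0 := by linarith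
    exact (mul_eq_zero.1 this).resolve_right hs.ne'
  · have e1 : ((τ θ : ℝ) : Real.Angle) = T₁ :=
      h.param_unique hn ho hb hconv ((hτ θ).congr hθc) hθ₁
    have e2 : ((τ (θ + π / 2 + arctan (f θ)) : ℝ) : Real.Angle) = T₂ :=
      h.param_unique hn ho hb hconv ((hτ _).congr hθ₂''.symm) hθ₂
    exact Prod.ext e1 e2

end FourPeriodic

/-! ### The differential of the billiard map -/

theorem hasDerivAt_det {g k : ℝ → Plane} {g' k' : Plane} {s : ℝ} (hg : HasDerivAt g g' s)
    (hk : HasDerivAt k k' s) :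
    HasDerivAt (fun u => det (g u) (k u)) (det g' (k s) + det (g s) k') s := by
  refine (((hasDerivAt_coord hg 0).mul (hasDerivAt_coord hk 1)).sub
    ((hasDerivAt_coord hg 1).mul (hasDerivAt_coord hk 0))).congr_deriv ?_
  simp only [det]; ring

section Differential

variable {n : WithTop ℕ∞} {γ : Real.Angle → Plane} {Ω : Set Plane} {c : Plane}

/-- Near a point of the phase space, the billiard map has a differentiable lift; its differential is
found by differentiating the collision law implicitly. -/
theorem IsBoundaryParam.exists_lift_billiardMap (h : IsBoundaryParam n γ Ω) (hn : 2 ≤ n)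
    (ho : IsOpen Ω) (hb : Bornology.IsBounded Ω) (hconv : Convex ℝ Ω)
    (hc : IsCentrallySymmetric Ω c) {T₁ T₂ T₃ : ℝ}
    (h12 : 0 < det (velocity γ (T₁ : Real.Angle)) (velocity γ (T₂ : Real.Angle)))
    (h23 : 0 < det (velocity γ (T₂ : Real.Angle)) (velocity γ (T₃ : Real.Angle)))
    (hlaw : det (velocity γ (T₂ : Real.Angle))
      (γ (T₃ : Real.Angle) - γ (T₁ : Real.Angle)) = 0) :
    ∃ (F : ℝ × ℝ → ℝ × ℝ) (D : ℝ × ℝ →L[ℝ] ℝ × ℝ), F (T₁, T₂) = (T₂, T₃) ∧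
      HasFDerivAt F D (T₁, T₂) ∧
      (∀ᶠ Z in 𝓝 (T₁, T₂), torusProj (F Z) = billiardMap γ (torusProj Z)) ∧
      ∀ w, (D w).1 = w.2 ∧
        det (velocity γ (T₂ : Real.Angle)) (velocity γ (T₃ : Real.Angle)) * (D w).2 =
          det (velocity γ (T₂ : Real.Angle)) (velocity γ (T₁ : Real.Angle)) * w.1 -
          det (velocity (velocity γ) (T₂ : Real.Angle))
            (γ (T₃ : Real.Angle) - γ (T₁ : Real.Angle)) * w.2 := by
  set Φ : (ℝ × ℝ) × ℝ → ℝ := fun q =>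
    det (velocity γ (q.1.2 : Real.Angle)) (γ (q.2 : Real.Angle) - γ (q.1.1 : Real.Angle)) with hΦ
  have hg : ContDiff ℝ 1 (fun s : ℝ => γ (s : Real.Angle)) :=
    h.contDiff.of_le (le_trans one_le_two hn)
  have hv : ContDiff ℝ 1 (fun s : ℝ => velocity γ (s : Real.Angle)) :=
    h.contDiff_velocity (by rw [one_add_one_eq_two]; exact hn)
  have hΦc : ContDiff ℝ 1 Φ := by
    have g3 := contDiff_euclidean.1 (hg.comp (contDiff_snd (E := ℝ × ℝ) (F := ℝ)))
    have g1 := contDiff_euclidean.1 (hg.comp (contDiff_fst.comp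
      (contDiff_fst (E := ℝ × ℝ) (F := ℝ))))
    have v2 := contDiff_euclidean.1 (hv.comp (contDiff_snd.comp
      (contDiff_fst (E := ℝ × ℝ) (F := ℝ))))
    exact ((v2 0).mul ((g3 1).sub (g1 1))).sub ((v2 1).mul ((g3 0).sub (g1 0)))
  set u : (ℝ × ℝ) × ℝ := ((T₁, T₂), T₃) with hu
  have hstrict : HasStrictFDerivAt Φ (fderiv ℝ Φ u) u :=
    hΦc.contDiffAt.hasStrictFDerivAt (by simp)
  have hval : ∀ (w : ℝ × ℝ) (z : ℝ), fderiv ℝ Φ u (w, z) =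
      w.2 * det (velocity (velocity γ) (T₂ : Real.Angle))
        (γ (T₃ : Real.Angle) - γ (T₁ : Real.Angle)) +
      z * det (velocity γ (T₂ : Real.Angle)) (velocity γ (T₃ : Real.Angle)) -
      w.1 * det (velocity γ (T₂ : Real.Angle)) (velocity γ (T₁ : Real.Angle)) := by
    intro w z
    have hline : ∀ a b : ℝ, HasDerivAt (fun s : ℝ => a + s * b) b 0 := fun a b => by
      simpa using ((hasDerivAt_id (0 : ℝ)).mul_const b).const_add a
    have hcurve : HasDerivAt
        (fun s : ℝ => (((T₁ + s * w.1, T₂ + s * w.2), T₃ + s * z) : (ℝ × ℝ) × ℝ)) (w, z) 0 :=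
      ((hline T₁ w.1).prodMk (hline T₂ w.2)).prodMk (hline T₃ z)
    have hΦu : HasFDerivAt Φ (fderiv ℝ Φ u)
        ((fun s : ℝ => (((T₁ + s * w.1, T₂ + s * w.2), T₃ + s * z) : (ℝ × ℝ) × ℝ)) 0) := by
      simpa [hu] using hstrict.hasFDerivAt
    have e1 := hΦu.comp_hasDerivAt (0 : ℝ) hcurve
    have c1 : HasDerivAt (fun s : ℝ => γ ((T₁ + s * w.1 : ℝ) : Real.Angle))
        (w.1 • velocity γ (T₁ : Real.Angle)) 0 := by
      refine HasDerivAt.scomp (0 : ℝ) (g₁ := fun s : ℝ => γ (s : Real.Angle)) ?_ (hline T₁ w.1)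
      simpa using h.hasDerivAt hn T₁
    have c3 : HasDerivAt (fun s : ℝ => γ ((T₃ + s * z : ℝ) : Real.Angle))
        (z • velocity γ (T₃ : Real.Angle)) 0 := by
      refine HasDerivAt.scomp (0 : ℝ) (g₁ := fun s : ℝ => γ (s : Real.Angle)) ?_ (hline T₃ z)
      simpa using h.hasDerivAt hn T₃
    have c2 : HasDerivAt (fun s : ℝ => velocity γ ((T₂ + s * w.2 : ℝ) : Real.Angle))
        (w.2 • velocity (velocity γ) (T₂ : Real.Angle)) 0 := by
      refine HasDerivAt.scomp (0 : ℝ) (g₁ := fun s : ℝ => velocity γ (s : Real.Angle)) ?_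
        (hline T₂ w.2)
      simpa using h.hasDerivAt_velocity hn T₂
    rw [e1.unique (hasDerivAt_det c2 (c3.sub c1))]
    simp [det]
    ring
  set A := fderiv ℝ Φ u ∘L .inr ℝ (ℝ × ℝ) ℝ with hA
  have hAz : ∀ z, A z = det (velocity γ (T₂ : Real.Angle)) (velocity γ (T₃ : Real.Angle)) * z := by
    intro z
    have := hval 0 z
    simp only [Prod.fst_zero, Prod.snd_zero, zero_mul, zero_add, sub_zero] at this
    simpa [hA, mul_comm] using this
  have hinv : A.IsInvertible := by
    refine ⟨ContinuousLinearEquiv.unitsEquivAut ℝ (Units.mk0 _ h23.ne'), ?_⟩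
    ext
    simp [hAz]
  set ψ := hstrict.implicitFunctionOfProdDomain hinv with hψ
  have hψd := (hstrict.hasStrictFDerivAt_implicitFunctionOfProdDomain hinv).hasFDerivAt
  have hψt := hstrict.tendsto_implicitFunctionOfProdDomain hinv
  have hψe := hstrict.eventually_apply_implicitFunctionOfProdDomain hinv
  have hψu : ψ (T₁, T₂) = T₃ :=
    tendsto_nhds_unique (hψd.continuousAt.tendsto) hψt
  refine ⟨fun Z => (Z.2, ψ Z), _, by simp only [hψu], hasFDerivAt_snd.prodMk hψd, ?_, ?_⟩
  · have hdc : Continuous fun q : ℝ × ℝ =>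
        det (velocity γ (q.1 : Real.Angle)) (velocity γ (q.2 : Real.Angle)) := by
      have v1 := hv.continuous.comp (continuous_fst (X := ℝ) (Y := ℝ))
      have v2 := hv.continuous.comp (continuous_snd (X := ℝ) (Y := ℝ))
      simp only [Function.comp_def] at v1 v2
      unfold det
      fun_prop
    have p12 : ∀ᶠ Z : ℝ × ℝ in 𝓝 (T₁, T₂),
        0 < det (velocity γ (Z.1 : Real.Angle)) (velocity γ (Z.2 : Real.Angle)) :=
      hdc.continuousAt.eventually (lt_mem_nhds h12)
    have p23 : ∀ᶠ Z : ℝ × ℝ in 𝓝 (T₁, T₂),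
        0 < det (velocity γ (Z.2 : Real.Angle)) (velocity γ (ψ Z : Real.Angle)) := by
      have ht : Tendsto (fun Z : ℝ × ℝ => (Z.2, ψ Z)) (𝓝 (T₁, T₂)) (𝓝 (T₂, T₃)) :=
        (continuous_snd.tendsto' (T₁, T₂) T₂ rfl).prodMk_nhds hψt
      exact (hdc.tendsto (T₂, T₃)).comp ht |>.eventually (lt_mem_nhds h23)
    filter_upwards [p12, p23, hψe] with Z h1 h2 h3
    have h4 : Φ (Z, ψ Z) = 0 := h3.trans hlaw
    exact Prod.ext rfl (h.nextBounce_eq hn ho hb hconv hc h1 h2 h4).symm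
  · intro w
    refine ⟨rfl, ?_⟩
    rw [← hAz]
    change A ((-A.inverse ∘L (fderiv ℝ Φ u ∘L .inl ℝ (ℝ × ℝ) ℝ)) w) = _
    have hw := hval w 0
    simp only [ContinuousLinearMap.comp_apply, neg_apply, map_neg,
      hinv.self_apply_inverse, ContinuousLinearMap.inl_apply, hw]
    ring

/-- The differential of the billiard map at a point whose next bounce is the antipode of the first
one, in terms of the tangential displacements `tangentComp (velocity γ T) θ * w` of the points.
Dividing these by the radii of curvature turns it into `y'' = -y + a y'`. -/
theorem IsBoundaryParam.differential_antipode (h : IsBoundaryParam n γ Ω) (hn : 2 ≤ n)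
    (ho : IsOpen Ω) (hb : Bornology.IsBounded Ω) (hconv : Convex ℝ Ω)
    (hc : IsCentrallySymmetric Ω c) {T T' T'' θ θ' : ℝ} (hT : SupportsAt γ T θ)
    (hT' : SupportsAt γ T' θ') (hT'' : SupportsAt γ T'' (θ + π)) (hs : 0 < sin (θ' - θ))
    (hpar : normalComp (γ (T : Real.Angle) - c) θ' = 0) :
    ∃ (F : ℝ × ℝ → ℝ × ℝ) (D : ℝ × ℝ →L[ℝ] ℝ × ℝ), F (T, T') = (T', T'') ∧
      HasFDerivAt F D (T, T') ∧
      (∀ᶠ Z in 𝓝 (T, T'), torusProj (F Z) = billiardMap γ (torusProj Z)) ∧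
      ∀ w, (D w).1 = w.2 ∧
        tangentComp (velocity γ (T'' : Real.Angle)) (θ + π) * (D w).2 =
          -(tangentComp (velocity γ (T : Real.Angle)) θ * w.1) +
          2 * supportFunction c Ω θ / sin (θ' - θ) ^ 2 *
          (tangentComp (velocity γ (T' : Real.Angle)) θ' * w.2 /
            (supportFunction c Ω θ' + deriv (deriv (supportFunction c Ω)) θ')) := by
  set P := supportFunction c Ω with hP
  have hanti := h.antipode hn ho hb hconv hc hT hT''
  have hdiff : γ (T'' : Real.Angle) - γ (T : Real.Angle) = (-2 : ℝ) • (γ (T : Real.Angle) - c) := by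
    rw [← sub_sub_sub_cancel_right _ _ c, hanti]
    module
  have hn' := h.normalComp_velocity_eq_zero hn hT'
  obtain ⟨hμ', hν'⟩ := h.comp_velocity hn hT'
  have hsin' : sin (θ + π - θ') = sin (θ' - θ) := by
    rw [show θ + π - θ' = π - (θ' - θ) by ring, sin_pi_sub]
  have hlaw : det (velocity γ (T' : Real.Angle))
      (γ (T'' : Real.Angle) - γ (T : Real.Angle)) = 0 := by
    rw [hdiff, det_eq_neg_of_normalComp_eq_zero hn']
    have : normalComp ((-2 : ℝ) • (γ (T : Real.Angle) - c)) θ'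
        = -2 * normalComp (γ (T : Real.Angle) - c) θ' := by simp [normalComp]; ring
    rw [this, hpar]; ring
  obtain ⟨F, D, hF, hFD, hev, hD⟩ := h.exists_lift_billiardMap hn ho hb hconv hc
    ((h.det_velocity_pos_iff hn hT hT').2 hs)
    ((h.det_velocity_pos_iff hn hT' hT'').2 (by rw [hsin']; exact hs)) hlaw
  refine ⟨F, D, hF, hFD, hev, fun w => ⟨(hD w).1, ?_⟩⟩
  have key := (hD w).2
  rw [h.det_velocity hn hT' hT'', h.det_velocity hn hT' hT, hsin', ← neg_sub θ' θ, sin_neg,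
    hdiff, det_eq_comp _ _ θ'] at key
  -- the position vector is tangential, of length `P θ / sin (θ' - θ)`
  have hn2 : normalComp ((-2 : ℝ) • (γ (T : Real.Angle) - c)) θ' = 0 := by
    have : normalComp ((-2 : ℝ) • (γ (T : Real.Angle) - c)) θ'
        = -2 * normalComp (γ (T : Real.Angle) - c) θ' := by simp [normalComp]; ring
    rw [this, hpar, mul_zero]
  have ht2 : tangentComp ((-2 : ℝ) • (γ (T : Real.Angle) - c)) θ' * sin (θ' - θ) = 2 * P θ := by
    have e1 : tangentComp ((-2 : ℝ) • (γ (T : Real.Angle) - c)) θ'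
        = -2 * tangentComp (γ (T : Real.Angle) - c) θ' := by simp [tangentComp]; ring
    have e2 := normalComp_rotate (γ (T : Real.Angle) - c) θ' θ
    rw [← h.supportFunction_eq ho hb c hT, hpar, ← neg_sub θ' θ, sin_neg] at e2
    rw [e1]
    linarith
  have hρ := h.supportFunction_curvature hn ho hb hconv c hT'
  have hρpos := h.supportFunction_curvature_pos hn ho hb hconv c θ'
  rw [← hP] at hρ hρpos
  rw [hn2, mul_zero, sub_zero] at key
  set ρ := P θ' + deriv (deriv P) θ' with hρdef
  set t := tangentComp ((-2 : ℝ) • (γ (T : Real.Angle) - c)) θ'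
  set μ := tangentComp (velocity γ (T : Real.Angle)) θ
  set μ' := tangentComp (velocity γ (T' : Real.Angle)) θ'
  set μ'' := tangentComp (velocity γ (T'' : Real.Angle)) (θ + π)
  set ν' := normalComp (velocity (velocity γ) (T' : Real.Angle)) θ'
  set s := sin (θ' - θ)
  have hν0 : ν' ≠ 0 := hν'.ne
  have hν'' : ν' = -(μ' ^ 2 / ρ) := by
    rw [hρ]; field_simp
  have ht : t = 2 * P θ / s := by rw [eq_div_iff hs.ne']; exact ht2
  rw [hν'', ht] at key
  have hs0 := hs.ne'
  have hμ0 := hμ'.ne'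
  have hρ0 := hρpos.ne'
  have hfin : μ' * s * (μ'' * (D w).2) = μ' * s * (-(μ * w.1) +
      2 * P θ / s ^ 2 * (μ' * w.2 / ρ)) := by
    have : μ' * s * (μ'' * (D w).2) = μ' * μ'' * s * (D w).2 := by ring
    rw [this, key]
    field_simp
    ring
  exact mul_left_cancel₀ (mul_ne_zero hμ0 hs0) hfin

/-- The fourth power of the differential at a conjugate pair has an eigenvalue `1` or `-1` only if
`a * b` is `0`, `2` or `4`. -/
theorem eq_zero_of_recursion {a b σ y₁ y₂ y₃ y₄ : ℝ} (hσ : σ = 1 ∨ σ = -1) (h0 : a * b ≠ 0)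
    (h2 : a * b ≠ 2) (h4 : a * b ≠ 4) (e3 : y₃ = -y₁ + a * y₂) (e4 : y₄ = -y₂ + b * y₃)
    (e5 : σ * y₁ = -y₃ + a * y₄) (e6 : σ * y₂ = -y₄ + b * (σ * y₁)) : y₁ = 0 ∧ y₂ = 0 := by
  have ha : a ≠ 0 := left_ne_zero_of_mul h0
  have h2' : a * b - 2 ≠ 0 := sub_ne_zero.2 h2
  have h4' : a * b - 4 ≠ 0 := sub_ne_zero.2 h4
  subst e4 e3
  rcases hσ with rfl | rfl
  · have k1 : a * (b * y₁ - (a * b - 2) * y₂) = 0 := by linear_combination e5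
    have k2 : b * y₁ = (a * b - 2) * y₂ := by
      have := (mul_eq_zero.1 k1).resolve_left ha
      linarith
    have k3 : (a * b - 4) * y₂ = 0 := by linear_combination -e6 - 2 * k2
    have hy2 := (mul_eq_zero.1 k3).resolve_left h4'
    have hb : b ≠ 0 := right_ne_zero_of_mul h0
    rw [hy2, mul_zero] at k2
    exact ⟨(mul_eq_zero.1 k2).resolve_left hb, hy2⟩
  · have k1 : (a * b - 2) * (y₁ - a * y₂) = 0 := by linear_combination e5
    have k2 : y₁ = a * y₂ := by
      have := (mul_eq_zero.1 k1).resolve_left h2'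
      linarith
    subst k2
    have k3 : (a * b - 2) * y₂ = 0 := by linear_combination e6
    have hy2 := (mul_eq_zero.1 k3).resolve_left h2'
    exact ⟨by rw [hy2, mul_zero], hy2⟩

end Differential

/-! ### Non-degeneracy -/

section Nondegenerate

variable {n : WithTop ℕ∞} {γ : Real.Angle → Plane} {Ω : Set Plane} {c : Plane}

theorem hasDerivAt_deriv_div {P : ℝ → ℝ} (hP : ContDiff ℝ 2 P) (hpos : ∀ θ, 0 < P θ) (θ : ℝ) :
    HasDerivAt (fun θ => deriv P θ / P θ)
      ((deriv (deriv P) θ * P θ - deriv P θ * deriv P θ) / P θ ^ 2) θ := by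
  have h1 : HasDerivAt P (deriv P θ) θ := (hP.differentiable (by simp) θ).hasDerivAt
  have hP' : ContDiff ℝ 1 (deriv P) := (contDiff_succ_iff_deriv (n := 1)).1
    (by rw [one_add_one_eq_two]; exact hP) |>.2.2
  have h2 : HasDerivAt (deriv P) (deriv (deriv P) θ) θ :=
    (hP'.differentiable (by simp) θ).hasDerivAt
  exact h2.div h1 (hpos θ).ne'

/-- At a conjugate pair, each factor of the multiplier is `sin² ψ` times the quotient of the radius
of curvature by the support function. -/
theorem multiplier_eq {P f' : ℝ → ℝ} (hP : ContDiff ℝ 2 P) (hpos : ∀ θ, 0 < P θ)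
    (hf : ∀ θ, HasDerivAt (fun θ => deriv P θ / P θ) (f' θ) θ) {θ₁ θ₂ : ℝ}
    (h : IsConjugatePair (fun θ => deriv P θ / P θ) θ₁ θ₂) :
    multiplier f' θ₁ θ₂ =
      (sin (θ₂ - θ₁) ^ 2 * (P θ₁ + deriv (deriv P) θ₁) / P θ₁) *
      (sin (θ₂ - θ₁) ^ 2 * (P θ₂ + deriv (deriv P) θ₂) / P θ₂) := by
  have hfac : ∀ θ, (deriv P θ / P θ * sin (θ₂ - θ₁)) ^ 2 = cos (θ₂ - θ₁) ^ 2 →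
      1 + sin (θ₂ - θ₁) ^ 2 * f' θ
        = sin (θ₂ - θ₁) ^ 2 * (P θ + deriv (deriv P) θ) / P θ := by
    intro θ hθ
    rw [(hf θ).unique (hasDerivAt_deriv_div hP hpos θ)]
    have hne := (hpos θ).ne'
    have hsc := sin_sq_add_cos_sq (θ₂ - θ₁)
    have e : sin (θ₂ - θ₁) ^ 2 * ((deriv (deriv P) θ * P θ - deriv P θ * deriv P θ) / P θ ^ 2)
        = sin (θ₂ - θ₁) ^ 2 * (deriv (deriv P) θ / P θ)
          - (deriv P θ / P θ * sin (θ₂ - θ₁)) ^ 2 := by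
      field_simp
    rw [e, hθ, mul_div_assoc, add_div, div_self hne]
    linear_combination -hsc
  rw [multiplier, hfac θ₁ (by rw [h.2.1]; ring), hfac θ₂ (by rw [h.2.2])]

theorem IsBoundaryParam.isNondegenerate (h : IsBoundaryParam n γ Ω) (hn : 2 ≤ n)
    (ho : IsOpen Ω) (hb : Bornology.IsBounded Ω) (hconv : Convex ℝ Ω)
    (hc : IsCentrallySymmetric Ω c) {f' : ℝ → ℝ}
    (hf : ∀ θ, HasDerivAt (fun θ => deriv (supportFunction c Ω) θ / supportFunction c Ω θ)
      (f' θ) θ)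
    (hmult : ∀ θ₁ θ₂, IsConjugatePair
      (fun θ => deriv (supportFunction c Ω) θ / supportFunction c Ω θ) θ₁ θ₂ →
      multiplier f' θ₁ θ₂ ≠ 1 ∧ multiplier f' θ₁ θ₂ ≠ 2)
    {x : Real.Angle × Real.Angle} (hx : x ∈ fourPeriodicPoints γ) : IsNondegenerate γ x := by
  set P := supportFunction c Ω with hP
  have hP2 : ContDiff ℝ 2 P := h.contDiff_two_supportFunction hn ho hb hconv c
  have hPπ : ∀ θ, P (θ + π) = P θ := h.supportFunction_add_pi ho hb hc
  have hP''π : ∀ θ, deriv (deriv P) (θ + π) = deriv (deriv P) θ :=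
    deriv_add_of_periodic (deriv_add_of_periodic hPπ)
  have hpos : ∀ θ, 0 < P θ := h.supportFunction_pos ho hb hc
  have hρ : ∀ θ, 0 < P θ + deriv (deriv P) θ := h.supportFunction_curvature_pos hn ho hb hconv c
  obtain ⟨T₁, T₂, θ₁, θ₂, rfl, hθ₁, hθ₂, hs, m1, m2⟩ :=
    h.fourPeriodic_normals hn ho hb hconv hc hx
  obtain ⟨T₃, hθ₃⟩ := h.exists_supportsAt (θ₁ + π)
  obtain ⟨T₄, hθ₄⟩ := h.exists_supportsAt (θ₂ + π)
  have hpp : ∀ θ : ℝ, (θ : Real.Angle) = (θ + π + π : ℝ) := fun θ => by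
    rw [add_assoc, Real.Angle.coe_add, Real.Angle.coe_add, Real.Angle.coe_pi_add_coe_pi, add_zero]
  have hθ₁' : SupportsAt γ T₁ (θ₁ + π + π) := hθ₁.congr (hpp θ₁)
  have hθ₂' : SupportsAt γ T₂ (θ₂ + π + π) := hθ₂.congr (hpp θ₂)
  have s2 : sin (θ₁ + π - θ₂) = sin (θ₂ - θ₁) := by
    rw [show θ₁ + π - θ₂ = π - (θ₂ - θ₁) by ring, sin_pi_sub]
  have s3 : sin (θ₂ + π - (θ₁ + π)) = sin (θ₂ - θ₁) := by congr 1; ring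
  have s4 : sin (θ₁ + π + π - (θ₂ + π)) = sin (θ₂ - θ₁) := by
    rw [← s2]; congr 1; ring
  have p2 : normalComp (γ (T₂ : Real.Angle) - c) (θ₁ + π) = 0 := by
    rw [normalComp_add_pi, m2, neg_zero]
  have p3 : normalComp (γ (T₃ : Real.Angle) - c) (θ₂ + π) = 0 := by
    rw [h.antipode hn ho hb hconv hc hθ₁ hθ₃, normalComp_neg, normalComp_add_pi, m1]; simp
  have p4 : normalComp (γ (T₄ : Real.Angle) - c) (θ₁ + π + π) = 0 := by
    rw [h.antipode hn ho hb hconv hc hθ₂ hθ₄, normalComp_neg, normalComp_add_pi, normalComp_add_pi,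
      m2]; simp
  -- the four steps
  obtain ⟨F₁, D₁, v1, d1, l1, r1⟩ :=
    h.differential_antipode hn ho hb hconv hc hθ₁ hθ₂ hθ₃ hs m1
  obtain ⟨F₂, D₂, v2, d2, l2, r2⟩ :=
    h.differential_antipode hn ho hb hconv hc hθ₂ hθ₃ hθ₄ (by rw [s2]; exact hs) p2
  obtain ⟨F₃, D₃, v3, d3, l3, r3⟩ :=
    h.differential_antipode hn ho hb hconv hc hθ₃ hθ₄ hθ₁' (by rw [s3]; exact hs) p3
  obtain ⟨F₄, D₄, v4, d4, l4, r4⟩ :=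
    h.differential_antipode hn ho hb hconv hc hθ₄ hθ₁' hθ₂' (by rw [s4]; exact hs) p4
  have t1 : Tendsto F₁ (𝓝 (T₁, T₂)) (𝓝 (T₂, T₃)) := v1 ▸ d1.continuousAt.tendsto
  have t2 : Tendsto F₂ (𝓝 (T₂, T₃)) (𝓝 (T₃, T₄)) := v2 ▸ d2.continuousAt.tendsto
  have t3 : Tendsto F₃ (𝓝 (T₃, T₄)) (𝓝 (T₄, T₁)) := v3 ▸ d3.continuousAt.tendsto
  have d21 : HasFDerivAt (F₂ ∘ F₁) (D₂ ∘L D₁) (T₁, T₂) :=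
    HasFDerivAt.comp _ (by rw [v1]; exact d2) d1
  have d321 : HasFDerivAt (F₃ ∘ (F₂ ∘ F₁)) (D₃ ∘L (D₂ ∘L D₁)) (T₁, T₂) :=
    HasFDerivAt.comp _ (by rw [Function.comp_apply, v1, v2]; exact d3) d21
  have d4321 : HasFDerivAt (F₄ ∘ (F₃ ∘ (F₂ ∘ F₁))) (D₄ ∘L (D₃ ∘L (D₂ ∘L D₁))) (T₁, T₂) :=
    HasFDerivAt.comp _ (by rw [Function.comp_apply, Function.comp_apply, v1, v2, v3]; exact d4) d321
  -- eigenvectors of the fourth power vanish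
  have eig : ∀ σ : ℝ, (σ = 1 ∨ σ = -1) → ∀ w : ℝ × ℝ,
      (D₄ ∘L (D₃ ∘L (D₂ ∘L D₁))) w = σ • w → w = 0 := by
    intro σ hσ w hw
    have hpair : IsConjugatePair (fun θ => deriv P θ / P θ) θ₁ θ₂ := by
      refine isConjugatePair_of_normalComp (c := c) hpos hs ?_ ?_
      · rw [← h.eq_envelope hn ho hb hconv c hθ₁, m1]
      · rw [← h.eq_envelope hn ho hb hconv c hθ₂, m2]
    have hm := hmult θ₁ θ₂ hpair
    rw [multiplier_eq hP2 hpos hf hpair] at hm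
    set w₃ := (D₁ w).2 with hw₃
    set w₄ := (D₂ (D₁ w)).2 with hw₄
    obtain ⟨q1, q1'⟩ := r1 w
    obtain ⟨q2, q2'⟩ := r2 (D₁ w)
    obtain ⟨q3, q3'⟩ := r3 (D₂ (D₁ w))
    obtain ⟨q4, q4'⟩ := r4 (D₃ (D₂ (D₁ w)))
    have f5 : (D₃ (D₂ (D₁ w))).2 = σ * w.1 := by
      rw [← q4]
      exact congrArg Prod.fst hw
    have f6 : (D₄ (D₃ (D₂ (D₁ w)))).2 = σ * w.2 := congrArg Prod.snd hw
    have f3 : (D₃ (D₂ (D₁ w))).1 = w₄ := q3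
    have f2 : (D₂ (D₁ w)).1 = w₃ := q2
    rw [q1] at q2'
    rw [f2, f5] at q3'
    rw [f3, f5, f6] at q4'
    rw [← hw₃] at q1' q2'
    rw [← hw₄] at q2' q3'
    rw [← hP] at q1' q2' q3' q4'
    rw [s2, hPπ, hP''π] at q2'
    rw [s3, hPπ, hPπ, hP''π] at q3'
    rw [s4, hPπ, hPπ, hPπ, hP''π, hP''π] at q4'
    have k1 : tangentComp (velocity γ (T₁ : Real.Angle)) (θ₁ + π + π)
        = tangentComp (velocity γ (T₁ : Real.Angle)) θ₁ := by
      rw [tangentComp_add_pi, tangentComp_add_pi, neg_neg]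
    have k2 : tangentComp (velocity γ (T₂ : Real.Angle)) (θ₂ + π + π)
        = tangentComp (velocity γ (T₂ : Real.Angle)) θ₂ := by
      rw [tangentComp_add_pi, tangentComp_add_pi, neg_neg]
    rw [k1] at q3' q4'
    rw [k2] at q4'
    have hμ₁ := (h.comp_velocity hn hθ₁).1.ne'
    have hμ₂ := (h.comp_velocity hn hθ₂).1.ne'
    have hρ₁ := hρ θ₁
    have hρ₂ := hρ θ₂
    have hP₁ := hpos θ₁
    have hP₂ := hpos θ₂
    set ρ₁ := P θ₁ + deriv (deriv P) θ₁
    set ρ₂ := P θ₂ + deriv (deriv P) θ₂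
    set μ₁ := tangentComp (velocity γ (T₁ : Real.Angle)) θ₁
    set μ₂ := tangentComp (velocity γ (T₂ : Real.Angle)) θ₂
    set μ₃ := tangentComp (velocity γ (T₃ : Real.Angle)) (θ₁ + π)
    set μ₄ := tangentComp (velocity γ (T₄ : Real.Angle)) (θ₂ + π)
    set s := sin (θ₂ - θ₁)
    set a := 2 * P θ₁ / (s ^ 2 * ρ₁) with ha
    set b := 2 * P θ₂ / (s ^ 2 * ρ₂) with hb'
    have hab : a * b * (s ^ 2 * ρ₁ / P θ₁ * (s ^ 2 * ρ₂ / P θ₂)) = 4 := by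
      rw [ha, hb']
      field_simp
      norm_num
    have hab0 : 0 < a * b := by positivity
    have hres := eq_zero_of_recursion (a := a) (b := b) (σ := σ) (y₁ := μ₁ * w.1 / ρ₁)
      (y₂ := μ₂ * w.2 / ρ₂) (y₃ := μ₃ * w₃ / ρ₁) (y₄ := μ₄ * w₄ / ρ₂) hσ hab0.ne'
      (by intro h2; rw [h2] at hab; exact hm.2 (by linarith))
      (by intro h4; rw [h4] at hab; exact hm.1 (by linarith))
      (by rw [q1', ha]; field_simp)
      (by rw [q2', hb']; field_simp)
      (by
        have : σ * (μ₁ * w.1 / ρ₁) = (μ₁ * (σ * w.1)) / ρ₁ := by ring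
        rw [this, q3', ha]; field_simp)
      (by
        have : σ * (μ₂ * w.2 / ρ₂) = (μ₂ * (σ * w.2)) / ρ₂ := by ring
        rw [this, q4', hb']; field_simp)
    obtain ⟨z1, z2⟩ := hres
    refine Prod.ext ?_ ?_
    · have := (div_eq_zero_iff.1 z1).resolve_right hρ₁.ne'
      exact (mul_eq_zero.1 this).resolve_left hμ₁
    · have := (div_eq_zero_iff.1 z2).resolve_right hρ₂.ne'
      exact (mul_eq_zero.1 this).resolve_left hμ₂
  refine ⟨D₄ ∘L (D₃ ∘L (D₂ ∘L D₁)), ⟨(T₁, T₂), F₄ ∘ (F₃ ∘ (F₂ ∘ F₁)), rfl, d4321, ?_⟩, ?_, ?_⟩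
  · filter_upwards [l1, t1.eventually l2, (t2.comp t1).eventually l3,
      (t3.comp (t2.comp t1)).eventually l4] with Z e1 e2 e3 e4
    simp only [Function.comp_apply] at e1 e2 e3 e4 ⊢
    rw [e4, e3, e2, e1]
    rfl
  · intro hE
    obtain ⟨w, hw⟩ := hE.exists_hasEigenvector
    exact hw.2 (eig 1 (Or.inl rfl) w hw.apply_eq_smul)
  · intro hE
    obtain ⟨w, hw⟩ := hE.exists_hasEigenvector
    exact hw.2 (eig (-1) (Or.inr rfl) w hw.apply_eq_smul)

/-- The set of `4`-periodic points is invariant under the billiard map. -/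
theorem IsBoundaryParam.mem_fourPeriodicPoints_of_orbit (h : IsBoundaryParam n γ Ω) (hn : 2 ≤ n)
    (ho : IsOpen Ω) (hb : Bornology.IsBounded Ω) (hconv : Convex ℝ Ω)
    (hc : IsCentrallySymmetric Ω c) {x : Real.Angle × Real.Angle}
    (hx : x ∈ fourPeriodicPoints γ) (m : ℕ) : (billiardMap γ)^[m] x ∈ fourPeriodicPoints γ := by
  induction m with
  | zero => exact hx
  | succ m ih =>
    rw [Function.iterate_succ_apply']
    refine ⟨?_, ih.2.apply⟩
    have h1 := (h.mem_phaseSpace_iff hn ho hb hconv _ _).1 ih.1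
    exact (h.mem_phaseSpace_iff hn ho hb hconv _ _).2
      (h.nextBounce_spec hn ho hb hconv hc h1).1

end Nondegenerate

/-! ### The perturbed support function -/

/-- The support function `p` perturbed so that its logarithmic derivative changes by `trigSum a`. -/
noncomputable def perturbed (p : ℝ → ℝ) (a : Fin 4 → ℝ) (θ : ℝ) : ℝ :=
  p θ * exp (trigPrimitive a θ)

theorem contDiff_perturbed {p : ℝ → ℝ} (hp : ContDiff ℝ ∞ p) :
    ContDiff ℝ ∞ fun q : (Fin 4 → ℝ) × ℝ => perturbed p q.1 q.2 := by
  unfold perturbed trigPrimitive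
  fun_prop

theorem perturbed_zero (p : ℝ → ℝ) : perturbed p 0 = p := by
  ext θ; simp [perturbed, trigPrimitive]

theorem perturbed_add_pi {p : ℝ → ℝ} (hp : ∀ θ, p (θ + π) = p θ) (a : Fin 4 → ℝ) (θ : ℝ) :
    perturbed p a (θ + π) = perturbed p a θ := by
  have e2 : 2 * (θ + π) = 2 * θ + 2 * π := by ring
  have e4 : 4 * (θ + π) = 4 * θ + 2 * π + 2 * π := by ring
  simp only [perturbed, trigPrimitive, hp, e2, e4, cos_add_two_pi, sin_add_two_pi]

theorem deriv_perturbed_div {p : ℝ → ℝ} (hp : Differentiable ℝ p) (hpos : ∀ θ, 0 < p θ)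
    (a : Fin 4 → ℝ) (θ : ℝ) :
    deriv (perturbed p a) θ / perturbed p a θ = deriv p θ / p θ + trigSum a θ := by
  have h := (hp θ).hasDerivAt.mul (hasDerivAt_trigPrimitive a θ).exp
  have hd : deriv (perturbed p a) θ = _ := h.deriv
  rw [hd, perturbed]
  have := (hpos θ).ne'
  have := (exp_pos (trigPrimitive a θ)).ne'
  field_simp

theorem exists_pos_le_of_periodic {f : ℝ → ℝ} (hf : Continuous f) (hper : ∀ θ, f (θ + π) = f θ)
    (hpos : ∀ θ, 0 < f θ) : ∃ δ, 0 < δ ∧ ∀ θ, δ ≤ f θ := by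
  obtain ⟨x, -, hx⟩ := (isCompact_Icc (a := 0) (b := π)).exists_isMinOn
    ⟨0, by constructor <;> linarith [pi_pos]⟩ hf.continuousOn
  refine ⟨f x, hpos x, fun θ => ?_⟩
  obtain ⟨y, hy, hxy⟩ := (show Function.Periodic f π from hper).exists_mem_Ico₀ pi_pos θ
  rw [hxy]
  exact hx ⟨hy.1, hy.2.le⟩

theorem ckNorm_sub_lt {k : ℕ} {f g : ℝ → ℝ} (hf : ContDiff ℝ k f) (hg : ContDiff ℝ k g) {η ε : ℝ}
    (hη : ∀ j ≤ k, ∀ θ, |iteratedDeriv j f θ - iteratedDeriv j g θ| ≤ η)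
    (hε : (k + 1) * η < ε) : ckNorm k (f - g) < ε := by
  refine lt_of_le_of_lt ?_ hε
  have h1 : ∀ j ∈ Finset.range (k + 1), (⨆ θ : ℝ, |iteratedDeriv j (f - g) θ|) ≤ η := by
    intro j hj
    have hjk : j ≤ k := by have := Finset.mem_range.1 hj; omega
    refine ciSup_le fun θ => ?_
    have hjk' : (j : WithTop ℕ∞) ≤ k := by exact_mod_cast hjk
    rw [iteratedDeriv_sub (hf.of_le hjk').contDiffAt (hg.of_le hjk').contDiffAt]
    exact hη j hjk θ
  have := Finset.sum_le_sum h1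
  simpa [ckNorm] using this

/-- A support function close to a given one, without resonant conjugate pairs. -/
theorem exists_nonresonant_approx {k : ℕ} (hk : 2 ≤ k) {p : ℝ → ℝ} (hp : ContDiff ℝ k p)
    (hpπ : ∀ θ, p (θ + π) = p θ) (hpos : ∀ θ, 0 < p θ)
    (hρ : ∀ θ, 0 < p θ + deriv (deriv p) θ) {η : ℝ} (hη : 0 < η) :
    ∃ P f' : ℝ → ℝ, ContDiff ℝ ∞ P ∧ (∀ θ, P (θ + π) = P θ) ∧ (∀ θ, 0 < P θ) ∧
      (∀ θ, 0 < P θ + deriv (deriv P) θ) ∧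
      (∀ j ≤ k, ∀ θ, |iteratedDeriv j p θ - iteratedDeriv j P θ| ≤ η) ∧
      (∀ θ, HasDerivAt (fun θ => deriv P θ / P θ) (f' θ) θ) ∧
      ∀ θ₁ θ₂, IsConjugatePair (fun θ => deriv P θ / P θ) θ₁ θ₂ →
        multiplier f' θ₁ θ₂ ≠ 1 ∧ multiplier f' θ₁ θ₂ ≠ 2 := by
  have hp2 : ContDiff ℝ 2 p := hp.of_le (by exact_mod_cast hk)
  have hp1 : ContDiff ℝ 1 (deriv p) := (contDiff_succ_iff_deriv (n := 1)).1
    (by rw [one_add_one_eq_two]; exact hp2) |>.2.2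
  obtain ⟨δ₁, hδ₁, hδ₁'⟩ := exists_pos_le_of_periodic hp.continuous hpπ hpos
  obtain ⟨δ₂, hδ₂, hδ₂'⟩ := exists_pos_le_of_periodic
    (f := fun θ => p θ + deriv (deriv p) θ) (hp.continuous.add (hp1.continuous_deriv le_rfl))
    (fun θ => by simp only [hpπ, deriv_add_of_periodic (deriv_add_of_periodic hpπ)]) hρ
  set ζ := min (η / 2) (min (δ₁ / 2) (δ₂ / 8)) with hζ
  have hζ0 : 0 < ζ := by positivity
  have z1 : ζ ≤ η / 2 := min_le_left _ _
  have z2 : ζ ≤ δ₁ / 2 := (min_le_right _ _).trans (min_le_left _ _)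
  have z3 : ζ ≤ δ₂ / 8 := (min_le_right _ _).trans (min_le_right _ _)
  obtain ⟨q, hq, hqπ, hqa⟩ := exists_smooth_periodic_approx_of_contDiff pi_pos k p hp hpπ ζ hζ0
  have hqpos : ∀ θ, 0 < q θ := fun θ => by
    have h1 := abs_le.1 (hqa 0 (by omega) θ)
    simp only [iteratedDeriv_zero] at h1
    linarith [hδ₁' θ]
  have hq' : ContDiff ℝ ∞ (deriv q) := (contDiff_infty_iff_deriv.1 hq).2
  set f : ℝ → ℝ := fun θ => deriv q θ / q θ with hf
  have hfs : ContDiff ℝ ∞ f := hq'.div hq fun θ => (hqpos θ).ne'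
  have hfs' : ContDiff ℝ ∞ (deriv f) := (contDiff_infty_iff_deriv.1 hfs).2
  have hnear := eventually_iteratedDeriv_close (contDiff_perturbed hq) pi_pos
    (fun a => perturbed_add_pi hqπ a) k hζ0 (0 : Fin 4 → ℝ)
  have hdense := dense_nonresonant (f := f) (f' := deriv f)
    (by exact_mod_cast contDiff_infty.1 hfs 1) (by exact_mod_cast contDiff_infty.1 hfs' 1)
  obtain ⟨a, ha, hres⟩ := mem_closure_iff_nhds.1 (hdense 0) _ hnear
  have hPs : ContDiff ℝ ∞ (perturbed q a) :=
    (contDiff_perturbed hq).comp (contDiff_const.prodMk contDiff_id)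
  have hlog : (fun θ => deriv (perturbed q a) θ / perturbed q a θ) = fun θ => f θ + trigSum a θ :=
    funext fun θ => deriv_perturbed_div (hq.differentiable (by simp)) hqpos a θ
  have hclose : ∀ j ≤ k, ∀ θ, |iteratedDeriv j p θ - iteratedDeriv j (perturbed q a) θ| ≤ 2 * ζ := by
    intro j hj θ
    have h1 := abs_le.1 (hqa j hj θ)
    have h2 := abs_lt.1 (ha j hj θ)
    simp only [perturbed_zero] at h2
    rw [abs_le]
    constructor <;> linarith
  refine ⟨perturbed q a, fun θ => deriv f θ + trigSumDeriv a θ, hPs, perturbed_add_pi hqπ a,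
    fun θ => mul_pos (hqpos θ) (exp_pos _), fun θ => ?_, fun j hj θ =>
    (hclose j hj θ).trans (by linarith), fun θ => ?_, fun θ₁ θ₂ hpair => ?_⟩
  · have h0 := abs_le.1 (hclose 0 (by omega) θ)
    have h2 := abs_le.1 (hclose 2 hk θ)
    simp only [iteratedDeriv_zero] at h0
    simp only [iteratedDeriv_succ, iteratedDeriv_zero] at h2
    linarith [hδ₂' θ]
  · rw [hlog]
    exact ((hfs.differentiable (by simp) θ).hasDerivAt).add (hasDerivAt_trigSum a θ)
  · rw [hlog] at hpair
    rw [Set.compl_union] at hres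
    exact ⟨fun h1 => hres.1 ⟨θ₁, θ₂, hpair, h1⟩, fun h2 => hres.2 ⟨θ₁, θ₂, hpair, h2⟩⟩

end SymplecticBilliard

open SymplecticBilliard
theorem lemma4p5 (k : ℕ) (hk : 2 ≤ k) (Ω : Set Plane) (c : Plane)
    (hΩ : IsStronglyConvexDomain k Ω) (hc : IsCentrallySymmetric Ω c) :
    ContDiff ℝ k (supportFunction c Ω) ∧
    ∀ ε : ℝ, 0 < ε → ∃ Ω' : Set Plane,
      IsStronglyConvexDomain ∞ Ω' ∧ IsCentrallySymmetric Ω' c ∧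
      ContDiff ℝ ∞ (supportFunction c Ω') ∧
      ckNorm k (supportFunction c Ω - supportFunction c Ω') < ε ∧
      ∀ γ : Real.Angle → Plane, IsBoundaryParam 2 γ Ω' →
        (fourPeriodicOrbits γ).Finite ∧
        ∀ O ∈ fourPeriodicOrbits γ, ∀ x ∈ O, IsNondegenerate γ x := by
  obtain ⟨ho, hb, hconv, γ₀, h₀⟩ := hΩ
  have hk' : (2 : WithTop ℕ∞) ≤ (k : WithTop ℕ∞) := by exact_mod_cast hk
  have hp := h₀.contDiff_supportFunction hk ho hb hconv c
  refine ⟨hp, fun ε hε => ?_⟩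
  obtain ⟨P, f', hP, hPπ, hPpos, hPρ, hclose, hf, hmult⟩ := exists_nonresonant_approx hk hp
    (h₀.supportFunction_add_pi ho hb hc) (h₀.supportFunction_pos ho hb hc)
    (h₀.supportFunction_curvature_pos hk' ho hb hconv c)
    (η := ε / (2 * (k + 1))) (by positivity)
  have hP2 : ContDiff ℝ 2 P := by exact_mod_cast contDiff_infty.1 hP 2
  have hper := two_pi_periodic hPπ
  have hsupp := supportFunction_supportDomain c hP2 hper hPpos hPρ
  have hdom := isStronglyConvexDomain_supportDomain c hP hper hPpos hPρ
  have hsym := isCentrallySymmetric_supportDomain c hP2 hPπ hPpos hPρ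
  refine ⟨supportDomain c P, hdom, hsym, by rw [hsupp]; exact hP, ?_, fun γ hγ => ?_⟩
  · rw [hsupp]
    refine ckNorm_sub_lt hp (contDiff_infty.1 hP k) hclose ?_
    field_simp
    linarith
  · have ho' := hdom.isOpen
    have hb' := hdom.isBounded
    have hconv' := hdom.convex
    rw [← hsupp] at hf hmult
    refine ⟨((hγ.finite_fourPeriodicPoints le_rfl ho' hb' hconv' hsym hf
      fun θ₁ θ₂ hpair => (hmult θ₁ θ₂ hpair).1).image _), ?_⟩
    rintro _ ⟨y, hy, rfl⟩ _ ⟨m, rfl⟩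
    exact hγ.isNondegenerate le_rfl ho' hb' hconv' hsym hf hmult
      (hγ.mem_fourPeriodicPoints_of_orbit le_rfl ho' hb' hconv' hsym hy m)
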